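/- **Theorem.** Let $\epsilon_1,\dots,\epsilon_n$ be distinct real numbers and consider the classical Jaynes–Cummings–Gaudin model: the phase space consists of the points $(b,\vec s_1,\dots,\vec s_n)\in\mathbb C\times(\mathbb R^3)^n$ with $\vec s_j\cdot\vec s_j=s^2$, with Poisson brackets $\{b,\bar b\}=i$, $\{s_j^a,s_j^b\}=-\epsilon_{abc}s_j^c$ (all other brackets between $b$ and the spins vanish), $s_j^\pm=s_j^1\pm i s_j^2$, $s_j^z=s_j^3$, and Hamiltonians $$H_j=2\epsilon_j s_j^z+b s_j^++\bar b s_j^-+\sum_{k\ne j}\frac{\vec s_j\cdot\vec s_k}{\epsilon_j-\epsilon_k}\quad(1\le j\le n),\qquad H_{n+1}=b\bar b+\sum_j s_j^z .$$ Put $A(\lambda)=2\lambda+\sum_j\frac{s_j^z}{\lambda-\epsilon_j}$, $B(\lambda)=2b+\sum_j\frac{s_j^-}{\lambda-\epsilon_j}$, $C(\lambda)=2\bar b+\sum_j\frac{s_j^+}{\lambda-\epsilon_j}$, and $L(\lambda)=\begin{pmatrix}A&B\\C&-A\end{pmatrix}$. With $y=\mu\prod_j(\lambda-\epsilon_j)$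 the spectral curve $\det(L(\lambda)-\mu)=0$ reads $y^2=Q_{2n+2}(\lambda)$, where $Q_{2n+2}=\prod_j(\lambda-\epsilon_j)^2\,(A^2+BC)$ is a polynomial of degree $2n+2$. The eigenvector of $L(\lambda)$ with second component $1$ has first component $\psi_1=(A(\lambda)+\mu)/C(\lambda)$, a meromorphic function on the curve. Fix $i\in\{1,\dots,n+1\}$ and let $x(t)$, $t$ in an open interval $J$, be a trajectory of the flow of $H_i$, i.e. $\partial_{t_i}f=\{H_i,f\}$ along $x$ for all observables $f$. Assume that $Q_{2n+2}$ has only simple roots at some time in $J$ and that for every $t\in J$ the function $\psi_1$ has $n$ distinct poles $p_k(t)=(\lambda_k(t),y_k(t))$ at finite distance (the separated variables, $y_k=\mu_k\prod_j(\lambda_k-\epsilon_j)$), labelled so that they depend continuously on $t$. Then: 1. $Q_{2n+2}$ does not depend on $t\in J$; let $\Gamma$ be the compact hyperelliptic curve $y^2=Q_{2n+2}(\lambda)$ of genus $n$. 2. The differentials $\sigma_j\,d\lambda$, $\sigma_j=\dfrac{\prod_{l\ne j}(\lambda-\epsilon_l)}{y}=\dfrac{1}{(\lambda-\epsilon_j)\mu}$,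 $1\le j\le n$, form a basis of the holomorphic differentials on $\Gamma$. 3. The $p_k$ are differentiable, and for all $t\in J$ and $1\le j\le n$ $$\sum_{k=1}^n \partial_{t_i}\lambda_k\;\sigma_j(\lambda_k,\mu_k)=i\,\delta_{ij},$$ where $\delta_{ij}=0$ for $i=n+1$, the imaginary unit is the factor in front of $\delta_{ij}$, and at a branch point ($y_k=0$) the term for $k$ means the value of the holomorphic differential $\sigma_j\,d\lambda$ on the velocity of $p_k$. 4. The flow is linear on the Jacobian: for every basis $\eta_1,\dots,\eta_n$ of the holomorphic differentials, $\eta_m=\sum_j a_{mj}\sigma_j\,d\lambda$, let $c_m=\sum_j a_{mj}\,i\,\delta_{ij}$ and let $\Lambda\subset\mathbb C^n$ be the group of periods of $(\eta_1,\dots,\eta_n)$. Then the sum over $k$ of the values of $\eta_m$ on the velocity of $p_k$ is the constant $c_m$, and for all base points $p_{0,k}$ on the affine curve the image of the divisor under the Abel map, $\theta_m(t)=\sum_k\int_{p_{0,k}}^{p_k(t)}\eta_m$, satisfies $$\theta(t_1)\equiv\theta(t_0)+(t_1-t_0)\,c\pmod\Lambda\qquad\text{for all }t_0,t_1\in J,$$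 whatever the paths of integration on the affine curve. -/

import Mathlib

open Polynomial Filter Topology

noncomputable section

namespace JCG

/-! ### Phase space, Poisson bracket, Hamiltonians -/

/-- The ambient space of the model: a point is `(b, s)` with `b ∈ ℂ` (the oscillator) and
`s j = (s_j^1, s_j^2, s_j^3) ∈ ℝ³` (the spins); `s_j^z = s_j^3`. -/
abbrev Phase (n : ℕ) : Type := ℂ × (Fin n → Fin 3 → ℝ)

variable {n : ℕ}

/-- The phase space: all spins have length `s`. -/
def phaseSpace (n : ℕ) (s : ℝ) : Set (Phase n) :=
  {x | ∀ j, ∑ a, x.2 j a ^ 2 = s ^ 2}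

/-- The complex conjugate variable of `b`. -/
def bbar (x : Phase n) : ℂ := (starRingEnd ℂ) x.1

/-- `s_j^z`. -/
def sz (x : Phase n) (j : Fin n) : ℂ := (x.2 j 2 : ℂ)

/-- `s_j^+ = s_j^1 + i s_j^2`. -/
def sPlus (x : Phase n) (j : Fin n) : ℂ := (x.2 j 0 : ℂ) + Complex.I * (x.2 j 1 : ℂ)

/-- `s_j^- = s_j^1 - i s_j^2`. -/
def sMinus (x : Phase n) (j : Fin n) : ℂ := (x.2 j 0 : ℂ) - Complex.I * (x.2 j 1 : ℂ)

/-- The scalar product of the spins `j` and `k`. -/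
def spinDot (x : Phase n) (j k : Fin n) : ℂ := ∑ a, (x.2 j a : ℂ) * (x.2 k a : ℂ)

/-- Partial derivative along `s_j^a`. -/
def dSpin (f : Phase n → ℂ) (x : Phase n) (j : Fin n) (a : Fin 3) : ℂ :=
  fderiv ℝ f x (0, Pi.single j (Pi.single a 1))

/-- Partial derivative along `Re b`. -/
def dRe (f : Phase n → ℂ) (x : Phase n) : ℂ := fderiv ℝ f x (1, 0)

/-- Partial derivative along `Im b`. -/
def dIm (f : Phase n → ℂ) (x : Phase n) : ℂ := fderiv ℝ f x (Complex.I, 0)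

/-- The Poisson bracket with `{b, b̄} = i` (that is `{Re b, Im b} = -1/2`) and
`{s_j^a, s_j^b} = - ε_{abc} s_j^c`; it is extended bilinearly to complex valued functions. -/
def poisson (f g : Phase n → ℂ) (x : Phase n) : ℂ :=
  -(1 / 2) * (dRe f x * dIm g x - dIm f x * dRe g x)
    - ∑ j, ((x.2 j 0 : ℂ) * (dSpin f x j 1 * dSpin g x j 2 - dSpin f x j 2 * dSpin g x j 1)
          + (x.2 j 1 : ℂ) * (dSpin f x j 2 * dSpin g x j 0 - dSpin f x j 0 * dSpin g x j 2)
          + (x.2 j 2 : ℂ) * (dSpin f x j 0 * dSpin g x j 1 - dSpin f x j 1 * dSpin g x j 0))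

/-- `H_j = 2 ε_j s_j^z + b s_j^+ + b̄ s_j^- + ∑_{k ≠ j} s_j · s_k / (ε_j - ε_k)`, `1 ≤ j ≤ n`. -/
def spinHamiltonian (ε : Fin n → ℝ) (j : Fin n) (x : Phase n) : ℂ :=
  2 * (ε j : ℂ) * sz x j + (x.1 * sPlus x j + bbar x * sMinus x j)
    + ∑ k ∈ Finset.univ.erase j, spinDot x j k / ((ε j : ℂ) - (ε k : ℂ))

/-- `H_{n+1} = b b̄ + ∑_j s_j^z`. -/
def numberHamiltonian (x : Phase n) : ℂ := x.1 * bbar x + ∑ j, sz x j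

/-- The `n + 1` Hamiltonians: index `j.castSucc` is `H_j`, the last index is `H_{n+1}`. -/
def hamiltonian (ε : Fin n → ℝ) (i : Fin (n + 1)) : Phase n → ℂ :=
  Fin.lastCases (motive := fun _ => Phase n → ℂ) numberHamiltonian (spinHamiltonian ε) i

/-- `x` satisfies on `J` the equations of motion `ḟ = {H, f}` of the Hamiltonian `H`
(for the coordinate functions `f = b` and `f = s_j^a`). -/
def IsHamiltonianTrajectory (H : Phase n → ℂ) (x : ℝ → Phase n) (J : Set ℝ) : Prop :=
  ∀ t ∈ J,
    HasDerivAt (fun τ => (x τ).1) (poisson H (fun z => z.1) (x t)) t ∧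
    ∀ j a, HasDerivAt (fun τ => (((x τ).2 j a : ℝ) : ℂ))
      (poisson H (fun z => ((z.2 j a : ℝ) : ℂ)) (x t)) t

/-! ### Lax matrix and spectral curve -/

/-- `A(l) = 2 l + ∑_j s_j^z / (l - ε_j)`. -/
def laxA (ε : Fin n → ℝ) (x : Phase n) (l : ℂ) : ℂ := 2 * l + ∑ j, sz x j / (l - ε j)

/-- `B(l) = 2 b + ∑_j s_j^- / (l - ε_j)`. -/
def laxB (ε : Fin n → ℝ) (x : Phase n) (l : ℂ) : ℂ := 2 * x.1 + ∑ j, sMinus x j / (l - ε j)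

/-- `C(l) = 2 b̄ + ∑_j s_j^+ / (l - ε_j)`. -/
def laxC (ε : Fin n → ℝ) (x : Phase n) (l : ℂ) : ℂ := 2 * bbar x + ∑ j, sPlus x j / (l - ε j)

/-- The Lax matrix. -/
def laxMatrix (ε : Fin n → ℝ) (x : Phase n) (l : ℂ) : Matrix (Fin 2) (Fin 2) ℂ :=
  !![laxA ε x l, laxB ε x l; laxC ε x l, -laxA ε x l]

/-- `∏_j (X - ε_j)`. -/
def poleProd (ε : Fin n → ℝ) : ℂ[X] := ∏ j, (X - C (ε j : ℂ))

/-- `∏_{l ≠ j} (X - ε_l)`. -/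
def poleProdErase (ε : Fin n → ℝ) (j : Fin n) : ℂ[X] :=
  ∏ l ∈ Finset.univ.erase j, (X - C (ε l : ℂ))

/-- The numerator `∏_j (X - ε_j) · (p + ∑_j r_j / (X - ε_j))`. -/
def numer (ε : Fin n → ℝ) (p : ℂ[X]) (r : Fin n → ℂ) : ℂ[X] :=
  p * poleProd ε + ∑ j, C (r j) * poleProdErase ε j

/-- The polynomial `Q_{2n+2} = ∏_j (X - ε_j)² · (A² + B C)`; see `spectralPoly_eval`. -/
def spectralPoly (ε : Fin n → ℝ) (x : Phase n) : ℂ[X] :=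
  numer ε (2 * X) (sz x) ^ 2
    + numer ε (C (2 * x.1)) (sMinus x) * numer ε (C (2 * bbar x)) (sPlus x)

/-- Poles of the Lax matrix are at the `ε_j`; elsewhere `numer` is what it should be. -/
theorem numer_eval (ε : Fin n → ℝ) (p : ℂ[X]) (r : Fin n → ℂ) (l : ℂ) (hl : ∀ j, l ≠ ε j) :
    (numer ε p r).eval l
      = (∏ j, (l - (ε j : ℂ))) * (p.eval l + ∑ j, r j / (l - (ε j : ℂ))) := by
  have key : ∀ j, (∏ i, (l - (ε i : ℂ))) * (r j / (l - (ε j : ℂ)))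
      = r j * ∏ i ∈ Finset.univ.erase j, (l - (ε i : ℂ)) := by
    intro j
    have h : l - (ε j : ℂ) ≠ 0 := sub_ne_zero.mpr (hl j)
    rw [← Finset.mul_prod_erase Finset.univ (fun i => l - (ε i : ℂ)) (Finset.mem_univ j)]
    field_simp
  rw [mul_add, Finset.mul_sum, Finset.sum_congr rfl (fun j _ => key j)]
  simp [numer, poleProd, poleProdErase, eval_prod, eval_finsetSum, mul_comm]

/-- `Q(l) = ∏_j (l - ε_j)² · (-det L(l))`: in terms of `y = μ ∏_j (l - ε_j)` the spectral curve
`det (L(l) - μ) = 0` is `y² = Q(l)`. -/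
theorem spectralPoly_eval (ε : Fin n → ℝ) (x : Phase n) (l : ℂ) (hl : ∀ j, l ≠ ε j) :
    (spectralPoly ε x).eval l = (∏ j, (l - (ε j : ℂ))) ^ 2 * (-(laxMatrix ε x l).det) := by
  simp only [spectralPoly, eval_add, eval_mul, eval_pow, numer_eval ε _ _ l hl, laxMatrix,
    Matrix.det_fin_two_of, laxA, laxB, laxC, eval_C, eval_X, eval_ofNat]
  ring

/-- The (affine part of the) hyperelliptic curve `y² = Q(l)`; points are pairs `(l, y)`. -/
def curve (Q : ℂ[X]) : Set (ℂ × ℂ) := {p | p.2 ^ 2 = Q.eval p.1}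

/-- The first component `(A(l) + μ) / C(l)` of the eigenvector of the Lax matrix whose second
component is `1`; see `laxMatrix_mulVec_psi`. -/
def psi (ε : Fin n → ℝ) (x : Phase n) (l μ : ℂ) : ℂ := (laxA ε x l + μ) / laxC ε x l

theorem laxMatrix_mulVec_psi (ε : Fin n → ℝ) (x : Phase n) (l μ : ℂ) (hC : laxC ε x l ≠ 0)
    (hμ : (laxMatrix ε x l - Matrix.scalar (Fin 2) μ).det = 0) :
    (laxMatrix ε x l).mulVec ![psi ε x l μ, 1] = μ • ![psi ε x l μ, 1] := by
  have h : laxB ε x l * laxC ε x l = μ ^ 2 - laxA ε x l ^ 2 := by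
    simp [laxMatrix, Matrix.det_fin_two] at hμ
    linear_combination -hμ
  ext i
  fin_cases i
  · simp [laxMatrix, psi, Matrix.mulVec, dotProduct, Fin.sum_univ_two]
    field_simp
    linear_combination h
  · simp [laxMatrix, psi, Matrix.mulVec, dotProduct, Fin.sum_univ_two]
    field_simp
    ring

/-- `p = (l, y)` is a pole (at finite distance) of the meromorphic function `psi` on the spectral
curve `y² = Q(l)`, where `μ = y / ∏_j (l - ε_j)`. -/
def IsPole (ε : Fin n → ℝ) (x : Phase n) (p : ℂ × ℂ) : Prop :=
  p ∈ curve (spectralPoly ε x) ∧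
  Tendsto (fun q : ℂ × ℂ => ‖psi ε x q.1 (q.2 / ∏ j, (q.1 - (ε j : ℂ)))‖)
    (𝓝[curve (spectralPoly ε x) \ {p}] p) atTop

/-! ### Holomorphic differentials, Abel map and Jacobian

`Q` is a squarefree polynomial of degree `2n + 2`. On the affine curve the differential `dl / y`
is holomorphic and has no zero, so that every differential is `f dl / y` with a function `f` on
the curve. A differential is represented by this function `f`, extended by `0` off the curve. -/

/-- The value of the differential `dl / y` at the point `p` on the tangent vector `v`.
At the branch points, `2 y dy = Q'(l) dl` gives `dl / y = 2 dy / Q'(l)`. -/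
def dlOverY (Q : ℂ[X]) (p v : ℂ × ℂ) : ℂ :=
  open Classical in
  if p.2 = 0 then 2 * v.2 / Q.derivative.eval p.1 else v.1 / p.2

/-- The value of the differential `f dl / y` at `p` on the tangent vector `v`. -/
def formValue (Q : ℂ[X]) (f : ℂ × ℂ → ℂ) (p v : ℂ × ℂ) : ℂ := f p * dlOverY Q p v

/-- The space of holomorphic differentials `f dl / y` on the compact hyperelliptic curve of genus
`n`. The second condition is holomorphy of `f` on the affine part. The third one is holomorphy at
the two points at infinity, which in the coordinates `l = 1 / u`, `y = w / u ^ (n + 1)` are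
`(u, w) = (0, w₀)` with `w₀ ^ 2` the leading coefficient of `Q`:
there `f dl / y = - f u ^ (n - 1) du / w`, and `du / w` is holomorphic without zero. -/
def holomorphicDifferentials (n : ℕ) (Q : ℂ[X]) : Submodule ℂ (ℂ × ℂ → ℂ) where
  carrier := {f |
    (∀ p, p ∉ curve Q → f p = 0) ∧
    (∀ p ∈ curve Q, ∃ F : ℂ × ℂ → ℂ, AnalyticAt ℂ F p ∧ ∀ᶠ q in 𝓝[curve Q] p, f q = F q) ∧
    (∀ w₀ : ℂ, w₀ ^ 2 = Q.coeff (2 * n + 2) → ∃ F : ℂ × ℂ → ℂ, AnalyticAt ℂ F (0, w₀) ∧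
      ∀ᶠ q in 𝓝 ((0 : ℂ), w₀), q.1 ≠ 0 → (1 / q.1, q.2 / q.1 ^ (n + 1)) ∈ curve Q →
        f (1 / q.1, q.2 / q.1 ^ (n + 1)) * q.1 ^ n = q.1 * F q)}
  add_mem' := by
    rintro f g ⟨hf0, hf1, hf2⟩ ⟨hg0, hg1, hg2⟩
    refine ⟨fun p hp => by simp [hf0 p hp, hg0 p hp], fun p hp => ?_, fun w hw => ?_⟩
    · obtain ⟨F, hF, hF'⟩ := hf1 p hp
      obtain ⟨G, hG, hG'⟩ := hg1 p hp
      refine ⟨F + G, hF.add hG, ?_⟩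
      filter_upwards [hF', hG'] with q h1 h2
      simp [h1, h2]
    · obtain ⟨F, hF, hF'⟩ := hf2 w hw
      obtain ⟨G, hG, hG'⟩ := hg2 w hw
      refine ⟨F + G, hF.add hG, ?_⟩
      filter_upwards [hF', hG'] with q h1 h2 h3 h4
      simp only [Pi.add_apply, add_mul, mul_add, h1 h3 h4, h2 h3 h4]
  zero_mem' := by
    refine ⟨fun _ _ => rfl, fun p _ => ⟨0, analyticAt_const, by simp⟩,
      fun w _ => ⟨0, analyticAt_const, by simp⟩⟩
  smul_mem' := by
    rintro c f ⟨hf0, hf1, hf2⟩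
    refine ⟨fun p hp => by simp [hf0 p hp], fun p hp => ?_, fun w hw => ?_⟩
    · obtain ⟨F, hF, hF'⟩ := hf1 p hp
      refine ⟨fun q => c * F q, analyticAt_const.mul hF, ?_⟩
      filter_upwards [hF'] with q h1
      simp [h1]
    · obtain ⟨F, hF, hF'⟩ := hf2 w hw
      refine ⟨fun q => c * F q, analyticAt_const.mul hF, ?_⟩
      filter_upwards [hF'] with q h1 h3 h4
      simp only [Pi.smul_apply, smul_eq_mul, mul_assoc, h1 h3 h4]
      ring

/-- A `C¹` arc, with parameter interval `[0, 1]`, on the affine curve. -/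
def IsArc (Q : ℂ[X]) (γ : ℝ → ℂ × ℂ) : Prop :=
  ContDiffOn ℝ 1 γ (Set.Icc 0 1) ∧ Set.MapsTo γ (Set.Icc 0 1) (curve Q)

/-- The integral of the differential `f dl / y` along a `C¹` arc. -/
def arcIntegral (Q : ℂ[X]) (f : ℂ × ℂ → ℂ) (γ : ℝ → ℂ × ℂ) : ℂ :=
  ∫ τ in (0 : ℝ)..1, formValue Q f (γ τ) (derivWithin γ (Set.Icc 0 1) τ)

/-- `PathIntegral Q η p q v`: there is a piecewise `C¹` path (a finite concatenation of `C¹` arcs)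
on the curve from `p` to `q` along which the integrals of the differentials `η j` are the `v j`. -/
inductive PathIntegral (Q : ℂ[X]) {m : ℕ} (η : Fin m → ℂ × ℂ → ℂ) :
    ℂ × ℂ → ℂ × ℂ → (Fin m → ℂ) → Prop
  | nil (p : ℂ × ℂ) (hp : p ∈ curve Q) : PathIntegral Q η p p 0
  | snoc (p : ℂ × ℂ) (v : Fin m → ℂ) (γ : ℝ → ℂ × ℂ) (hv : PathIntegral Q η p (γ 0) v)
      (hγ : IsArc Q γ) : PathIntegral Q η p (γ 1) (fun j => v j + arcIntegral Q (η j) γ)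

/-- The period lattice: the group generated by the integrals of the `η j` along closed paths.
(Closed paths on the compact curve can be moved off the two points at infinity, so that the affine
curve gives all periods.) -/
def periodLattice (Q : ℂ[X]) {m : ℕ} (η : Fin m → ℂ × ℂ → ℂ) : AddSubgroup (Fin m → ℂ) :=
  AddSubgroup.closure {v | ∃ p, PathIntegral Q η p p v}

/-- The Jacobian of the curve, in the coordinates given by a basis `η` of the holomorphic
differentials. -/
abbrev Jacobian (Q : ℂ[X]) {m : ℕ} (η : Fin m → ℂ × ℂ → ℂ) : Type :=
  (Fin m → ℂ) ⧸ periodLattice Q η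

/-- `u` is the image under the Abel map, with base points `p₀ k`, of the divisor `∑_k D k`:
`u_j = ∑_k ∫_{p₀ k}^{D k} η_j` modulo periods. -/
def IsAbelImage (Q : ℂ[X]) {m N : ℕ} (η : Fin m → ℂ × ℂ → ℂ) (p₀ D : Fin N → ℂ × ℂ)
    (u : Jacobian Q η) : Prop :=
  ∃ v : Fin N → Fin m → ℂ, (∀ k, PathIntegral Q η (p₀ k) (D k) (v k)) ∧
    u = QuotientAddGroup.mk (∑ k, v k)

end JCG

end

/-!
Write `a`, `b`, `c` for the numerators of the entries `A`, `B`, `C` of the Lax matrix and `Q` for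
`a² + b c`. The proof never changes coordinates on phase space; everything follows from the Lax
equation `dL/dt = (i / 2) [S_j, L] / (l - ε_j)` of the flow of `H_j`, where `S_j` is the residue of
`L` at `ε_j` (`lax_velA`, `lax_velB`, `lax_velC`). It shows at once that `Q` does not move
(`spectralPoly_const`).

A pole of the eigenvector is a point `(l, y)` with `c(l) = 0` and `y = a(l)`
(`IsPole.numC_ne_zero_and`). Since `c` has degree at most `n`, the `n` separated variables are all
its zeros, and they are simple. Hence they are differentiable, and the Lax equation at a zero
of `c` gives the Dubrovin equations (`hasDerivAt_separated`)
`dl_k/dt = y_k w_k`, `dy_k/dt = Q'(l_k) w_k / 2`, with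
`w_k = i ∏_{r ≠ k} (ε_j - l_r) / (l_k - l_r) / ∏_{m ≠ j} (ε_j - ε_m)`.
In this form branch points play no special role: `w_k` is the value of `dl / y` on the velocity.
The sum over `k` of `w_k ∏_{m ≠ r} (l_k - ε_m)` is Lagrange interpolation at the nodes `l_k`,
evaluated at `ε_j`; this is the linearity of the flow
(`sum_eval_poleProdErase_mul_separatedSpeed`). For `H_{n+1}` all `w_k` vanish.

That the `σ_j` form a basis of the holomorphic differentials is Liouville's theorem: the even part
of `f` under `y ↦ -y` and `y` times the odd part are entire functions of `l` with polynomial growth,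
hence polynomials, and the second one vanishes since it has too many zeros
(`exists_polynomial_of_mem_holomorphicDifferentials`).

Finally the trajectories of the separated variables are `C¹` arcs with time parameter, so the sum of
the integrals along them is `(t₁ - t₀) c`, and two paths with the same end points differ by a period
(`IsAbelImage.eq_add`).
-/

noncomputable section

namespace JCG

variable {n : ℕ}

/-! ### Equations of motion -/

/-- A spin component as a complex valued continuous linear function on the ambient space. -/
def spinCLM (j : Fin n) (a : Fin 3) : Phase n →L[ℝ] ℂ :=
  Complex.ofRealCLM.comp ((ContinuousLinearMap.proj a).comp
    ((ContinuousLinearMap.proj j).comp (ContinuousLinearMap.snd ℝ ℂ (Fin n → Fin 3 → ℝ))))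

@[simp] theorem spinCLM_apply (j : Fin n) (a : Fin 3) (v : Phase n) :
    spinCLM j a v = (v.2 j a : ℂ) := rfl

theorem hasFDerivAt_spin (j : Fin n) (a : Fin 3) (x : Phase n) :
    HasFDerivAt (fun z : Phase n => ((z.2 j a : ℝ) : ℂ)) (spinCLM j a) x :=
  (spinCLM j a).hasFDerivAt

theorem hasFDerivAt_bbar (x : Phase n) :
    HasFDerivAt (bbar : Phase n → ℂ) ((Complex.conjCLE : ℂ →L[ℝ] ℂ).comp
      (ContinuousLinearMap.fst ℝ ℂ (Fin n → Fin 3 → ℝ))) x :=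
  ((Complex.conjCLE : ℂ →L[ℝ] ℂ).comp
    (ContinuousLinearMap.fst ℝ ℂ (Fin n → Fin 3 → ℝ))).hasFDerivAt

theorem hasFDerivAt_sPlus (j : Fin n) (x : Phase n) :
    HasFDerivAt (fun z : Phase n => sPlus z j) (spinCLM j 0 + Complex.I • spinCLM j 1) x :=
  (spinCLM j 0 + Complex.I • spinCLM j 1).hasFDerivAt

theorem hasFDerivAt_sMinus (j : Fin n) (x : Phase n) :
    HasFDerivAt (fun z : Phase n => sMinus z j) (spinCLM j 0 - Complex.I • spinCLM j 1) x :=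
  (spinCLM j 0 - Complex.I • spinCLM j 1).hasFDerivAt

theorem fderiv_numberHamiltonian (x v : Phase n) :
    fderiv ℝ numberHamiltonian x v = v.1 * bbar x + x.1 * bbar v + ∑ j, sz v j := by
  have h := (hasFDerivAt_fst.mul (hasFDerivAt_bbar x)).add
    (HasFDerivAt.fun_sum (u := Finset.univ) fun j _ => hasFDerivAt_spin j 2 x)
  have h' : HasFDerivAt numberHamiltonian _ x := h
  rw [h'.fderiv]
  simp [sz, bbar]
  ring

theorem fderiv_spinHamiltonian (ε : Fin n → ℝ) (j : Fin n) (x v : Phase n) :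
    fderiv ℝ (spinHamiltonian ε j) x v =
      2 * (ε j : ℂ) * sz v j + (v.1 * sPlus x j + x.1 * sPlus v j
        + (bbar v * sMinus x j + bbar x * sMinus v j))
      + ∑ k ∈ Finset.univ.erase j, (∑ a, ((v.2 j a : ℂ) * (x.2 k a : ℂ)
          + (x.2 j a : ℂ) * (v.2 k a : ℂ))) / ((ε j : ℂ) - (ε k : ℂ)) := by
  have h := (((hasFDerivAt_spin j 2 x).const_mul (2 * (ε j : ℂ))).add
    ((hasFDerivAt_fst.mul (hasFDerivAt_sPlus j x)).add
      ((hasFDerivAt_bbar x).mul (hasFDerivAt_sMinus j x)))).add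
    (HasFDerivAt.fun_sum (u := Finset.univ.erase j) fun k _ =>
      (HasFDerivAt.fun_sum (u := Finset.univ) fun a _ =>
        (hasFDerivAt_spin j a x).mul (hasFDerivAt_spin k a x)).mul_const
          ((ε j : ℂ) - (ε k : ℂ))⁻¹)
  have h' : HasFDerivAt (spinHamiltonian ε j) _ x := h
  rw [h'.fderiv]
  simp only [add_apply, smul_apply, sum_apply, sub_apply, spinCLM_apply, smul_eq_mul,
    ContinuousLinearMap.comp_apply, ContinuousLinearMap.coe_fst']
  simp only [sz, sPlus, sMinus, bbar, div_eq_mul_inv, ContinuousLinearEquiv.coe_coe,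
    Complex.conjCLE_apply]
  congr 1
  · ring
  · refine Finset.sum_congr rfl fun k _ => ?_
    rw [mul_comm]
    congr 1
    exact Finset.sum_congr rfl fun a _ => by ring

theorem poisson_spin (f : Phase n → ℂ) (x : Phase n) (k : Fin n) (c : Fin 3) :
    poisson f (fun z => ((z.2 k c : ℝ) : ℂ)) x =
      ![dSpin f x k 1 * x.2 k 2 - dSpin f x k 2 * x.2 k 1,
        dSpin f x k 2 * x.2 k 0 - dSpin f x k 0 * x.2 k 2,
        dSpin f x k 0 * x.2 k 1 - dSpin f x k 1 * x.2 k 0] c := by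
  have h : ∀ j a, dSpin (fun z : Phase n => ((z.2 k c : ℝ) : ℂ)) x j a
      = if j = k then (if a = c then 1 else 0) else 0 := by
    intro j a
    rw [dSpin, (hasFDerivAt_spin k c x).fderiv, spinCLM_apply]
    by_cases hj : j = k
    · subst hj
      simp [Pi.single_apply, eq_comm, apply_ite Complex.ofReal]
    · simp [hj]
  have h1 : dRe (fun z : Phase n => ((z.2 k c : ℝ) : ℂ)) x = 0 := by
    rw [dRe, (hasFDerivAt_spin k c x).fderiv, spinCLM_apply]; simp
  have h2 : dIm (fun z : Phase n => ((z.2 k c : ℝ) : ℂ)) x = 0 := by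
    rw [dIm, (hasFDerivAt_spin k c x).fderiv, spinCLM_apply]; simp
  simp only [poisson, h, h1, h2]
  rw [Finset.sum_eq_single k]
  · fin_cases c <;> simp <;> ring
  · intro j _ hj
    simp [hj]
  · simp

theorem poisson_fst (f : Phase n → ℂ) (x : Phase n) :
    poisson f (fun z => z.1) x = -(1 / 2) * (Complex.I * dRe f x - dIm f x) := by
  have h : ∀ v, fderiv ℝ (fun z : Phase n => z.1) x v = v.1 := by
    intro v
    rw [(hasFDerivAt_fst (𝕜 := ℝ) (p := x)).fderiv]
    rfl
  simp only [poisson, dSpin, h]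
  simp only [dRe, dIm, h]
  simp
  ring

theorem dSpin_spinHamiltonian_self (ε : Fin n → ℝ) (j : Fin n) (x : Phase n) (a : Fin 3) :
    dSpin (spinHamiltonian ε j) x j a =
      ![x.1 + bbar x, Complex.I * (x.1 - bbar x), 2 * (ε j : ℂ)] a
        + ∑ k ∈ Finset.univ.erase j, (x.2 k a : ℂ) / ((ε j : ℂ) - (ε k : ℂ)) := by
  rw [dSpin, fderiv_spinHamiltonian]
  congr 1
  · fin_cases a <;> simp [sz, sPlus, sMinus, bbar]
    ring
  · refine Finset.sum_congr rfl fun k hk => ?_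
    congr 1
    simp [Pi.single_apply, Finset.ne_of_mem_erase hk, apply_ite Complex.ofReal]

theorem dSpin_spinHamiltonian_of_ne (ε : Fin n → ℝ) {j k : Fin n} (hk : k ≠ j) (x : Phase n)
    (a : Fin 3) :
    dSpin (spinHamiltonian ε j) x k a = (x.2 j a : ℂ) / ((ε j : ℂ) - (ε k : ℂ)) := by
  rw [dSpin, fderiv_spinHamiltonian]
  rw [Finset.sum_eq_single k]
  · simp [Pi.single_apply, sz, sPlus, sMinus, bbar, hk.symm, apply_ite Complex.ofReal]
  · intro l _ hl
    simp [hl, hk.symm]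
  · intro h
    simp [hk] at h

theorem poisson_spinHamiltonian_fst (ε : Fin n → ℝ) (j : Fin n) (x : Phase n) :
    poisson (spinHamiltonian ε j) (fun z => z.1) x = -Complex.I * sMinus x j := by
  rw [poisson_fst, dRe, dIm, fderiv_spinHamiltonian, fderiv_spinHamiltonian]
  simp [sz, sPlus, sMinus, bbar]
  ring_nf

theorem poisson_numberHamiltonian_fst (x : Phase n) :
    poisson numberHamiltonian (fun z => z.1) x = -Complex.I * x.1 := by
  rw [poisson_fst, dRe, dIm, fderiv_numberHamiltonian, fderiv_numberHamiltonian]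
  simp [sz, bbar]
  ring

theorem poisson_numberHamiltonian_spin (x : Phase n) (k : Fin n) (c : Fin 3) :
    poisson numberHamiltonian (fun z => ((z.2 k c : ℝ) : ℂ)) x
      = ![-(x.2 k 1 : ℂ), (x.2 k 0 : ℂ), 0] c := by
  have h : ∀ a, dSpin numberHamiltonian x k a = ![0, 0, 1] a := by
    intro a
    rw [dSpin, fderiv_numberHamiltonian]
    have : ∀ j : Fin n, sz ((0, Pi.single k (Pi.single a 1)) : Phase n) j
        = if j = k then (if a = 2 then 1 else 0) else 0 := by
      intro j
      by_cases hj : j = k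
      · subst hj
        simp [sz, Pi.single_apply, eq_comm, apply_ite Complex.ofReal]
      · simp [sz, hj]
    simp only [this]
    fin_cases a <;> simp [bbar]
  rw [poisson_spin]
  simp only [h]
  fin_cases c <;> simp

/-- The vector product of two spins. -/
def spinCross (x : Phase n) (j k : Fin n) : Fin 3 → ℂ :=
  ![(x.2 j 1 : ℂ) * x.2 k 2 - x.2 j 2 * x.2 k 1,
    (x.2 j 2 : ℂ) * x.2 k 0 - x.2 j 0 * x.2 k 2,
    (x.2 j 0 : ℂ) * x.2 k 1 - x.2 j 1 * x.2 k 0]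

/-- The velocity of the spin `j` caused by the oscillator and the external field. -/
def fieldTorque (ε : Fin n → ℝ) (x : Phase n) (j : Fin n) : Fin 3 → ℂ :=
  ![Complex.I * (x.1 - bbar x) * x.2 j 2 - 2 * ε j * x.2 j 1,
    2 * ε j * x.2 j 0 - (x.1 + bbar x) * x.2 j 2,
    (x.1 + bbar x) * x.2 j 1 - Complex.I * (x.1 - bbar x) * x.2 j 0]

/-- The spin velocities in the flow of `H_j`, summed up with the Cauchy kernel: the exchange terms
combine by `1 / ((l - ε_j) (l - ε_k)) = (1 / (l - ε_j) - 1 / (l - ε_k)) / (ε_j - ε_k)`. -/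
theorem sum_poisson_spinHamiltonian_div (ε : Fin n → ℝ) (hε : Function.Injective ε) (j : Fin n)
    (x : Phase n) (c : Fin 3) (l : ℂ) (hl : ∀ k, l ≠ ε k) :
    ∑ k, poisson (spinHamiltonian ε j) (fun z => ((z.2 k c : ℝ) : ℂ)) x / (l - ε k)
      = (fieldTorque ε x j c - ∑ k, spinCross x j k c / (l - ε k)) / (l - ε j) := by
  have hself : poisson (spinHamiltonian ε j) (fun z => ((z.2 j c : ℝ) : ℂ)) x
      = fieldTorque ε x j c
        - ∑ k ∈ Finset.univ.erase j, spinCross x j k c / ((ε j : ℂ) - (ε k : ℂ)) := by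
    rw [poisson_spin]
    simp only [dSpin_spinHamiltonian_self]
    fin_cases c <;>
    · simp [fieldTorque, spinCross, add_mul, Finset.sum_mul, sub_div, Finset.sum_sub_distrib]
      have e1 : ∀ (u v : Fin 3), ∑ k,
          (x.2 k u : ℂ) / ((ε j : ℂ) - (ε k : ℂ)) * x.2 j v
          = ∑ k, (x.2 j v : ℂ) * x.2 k u / ((ε j : ℂ) - (ε k : ℂ)) :=
        fun u v => Finset.sum_congr rfl fun k _ => by ring
      simp only [e1]
      ring
  have hne : ∀ k ≠ j, poisson (spinHamiltonian ε j) (fun z => ((z.2 k c : ℝ) : ℂ)) x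
      = spinCross x j k c / ((ε j : ℂ) - (ε k : ℂ)) := by
    intro k hk
    rw [poisson_spin]
    simp only [dSpin_spinHamiltonian_of_ne ε hk]
    fin_cases c <;> simp [spinCross] <;> ring
  have hjj : spinCross x j j c = 0 := by
    fin_cases c <;> simp [spinCross] <;> ring
  rw [← Finset.add_sum_erase _ _ (Finset.mem_univ j), hself,
    ← Finset.add_sum_erase (a := j) _ (fun k => spinCross x j k c / (l - ε k)) (Finset.mem_univ j),
    hjj, sub_div, zero_div, zero_add, sub_div, sub_add, Finset.sum_div, Finset.sum_div,
    ← Finset.sum_sub_distrib]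
  congr 1
  refine Finset.sum_congr rfl fun k hk => ?_
  have hk' := Finset.ne_of_mem_erase hk
  rw [hne k hk']
  have h1 : (ε j : ℂ) - ε k ≠ 0 :=
    sub_ne_zero.mpr fun h => hk' (hε (by exact_mod_cast h)).symm
  have h2 := sub_ne_zero.mpr (hl j)
  have h3 := sub_ne_zero.mpr (hl k)
  field_simp
  ring

/-! ### The Lax equation for the numerators -/

/-- The numerator of `A`. -/
def numA (ε : Fin n → ℝ) (x : Phase n) : ℂ[X] := numer ε (2 * X) (sz x)

/-- The numerator of `B`. -/
def numB (ε : Fin n → ℝ) (x : Phase n) : ℂ[X] := numer ε (C (2 * x.1)) (sMinus x)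

/-- The numerator of `C`. -/
def numC (ε : Fin n → ℝ) (x : Phase n) : ℂ[X] := numer ε (C (2 * bbar x)) (sPlus x)

theorem spectralPoly_eq (ε : Fin n → ℝ) (x : Phase n) :
    spectralPoly ε x = numA ε x ^ 2 + numB ε x * numC ε x := rfl

/-- The velocity of `s_k^c` in the flow of `H`. -/
def spinVel (H : Phase n → ℂ) (x : Phase n) (c : Fin 3) (k : Fin n) : ℂ :=
  poisson H (fun z => ((z.2 k c : ℝ) : ℂ)) x

/-- The velocity of `numA` in the flow of `H`. -/
def velA (ε : Fin n → ℝ) (H : Phase n → ℂ) (x : Phase n) : ℂ[X] :=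
  numer ε 0 (spinVel H x 2)

/-- The velocity of `numB` in the flow of `H`. -/
def velB (ε : Fin n → ℝ) (H : Phase n → ℂ) (x : Phase n) : ℂ[X] :=
  numer ε (C (2 * poisson H (fun z => z.1) x))
    (fun k => spinVel H x 0 k - Complex.I * spinVel H x 1 k)

/-- The velocity of `numC` in the flow of `H`. -/
def velC (ε : Fin n → ℝ) (H : Phase n → ℂ) (x : Phase n) : ℂ[X] :=
  numer ε (C (2 * (starRingEnd ℂ) (poisson H (fun z => z.1) x)))
    (fun k => spinVel H x 0 k + Complex.I * spinVel H x 1 k)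

/-- Polynomials which agree off the points `ε_j` are equal. -/
theorem polynomial_ext_off (ε : Fin n → ℝ) {p q : ℂ[X]}
    (h : ∀ l : ℂ, (∀ j, l ≠ ε j) → p.eval l = q.eval l) : p = q := by
  refine eq_of_infinite_eval_eq p q
    (Set.Infinite.mono (s := (Set.range fun j => (ε j : ℂ))ᶜ) ?_ ?_)
  · intro l hl
    exact h l fun j hj => hl ⟨j, hj.symm⟩
  · exact (Set.finite_range _).infinite_compl

theorem lax_velC (ε : Fin n → ℝ) (hε : Function.Injective ε) (j : Fin n) (x : Phase n) :
    (X - C (ε j : ℂ)) * velC ε (spinHamiltonian ε j) x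
      = C Complex.I * (C (sPlus x j) * numA ε x - C (sz x j) * numC ε x) := by
  refine polynomial_ext_off ε fun l hl => ?_
  have hj := sub_ne_zero.mpr (hl j)
  simp only [velC, numA, numC, eval_mul, eval_sub, eval_X, eval_C, numer_eval ε _ _ l hl,
    add_div, Finset.sum_add_distrib, mul_div_assoc, ← Finset.mul_sum,
    spinVel, sum_poisson_spinHamiltonian_div ε hε j x _ l hl, poisson_spinHamiltonian_fst]
  have e1 : ∑ k, spinCross x j k 0 / (l - ε k) + Complex.I * ∑ k, spinCross x j k 1 / (l - ε k)
      = -Complex.I * (sPlus x j * ∑ k, sz x k / (l - ε k)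
        - sz x j * ∑ k, sPlus x k / (l - ε k)) := by
    simp only [Finset.mul_sum, ← Finset.sum_add_distrib, ← Finset.sum_sub_distrib]
    refine Finset.sum_congr rfl fun k _ => ?_
    simp [spinCross, sPlus, sz]
    linear_combination ((x.2 j 1 * x.2 k 2 - x.2 j 2 * x.2 k 1) / (l - ε k)) * Complex.I_sq
  have e2 : fieldTorque ε x j 0 + Complex.I * fieldTorque ε x j 1
      = 2 * Complex.I * (ε j * sPlus x j - bbar x * sz x j) := by
    simp [fieldTorque, sPlus, sz]
    linear_combination (-2 * ε j * x.2 j 1 : ℂ) * Complex.I_sq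
  have e3 : (starRingEnd ℂ) (-Complex.I * sMinus x j) = Complex.I * sPlus x j := by
    simp [sMinus, sPlus]
  rw [e3]
  field_simp
  simp
  linear_combination (∏ k, (l - ε k)) * (e2 - e1)

theorem lax_velB (ε : Fin n → ℝ) (hε : Function.Injective ε) (j : Fin n) (x : Phase n) :
    (X - C (ε j : ℂ)) * velB ε (spinHamiltonian ε j) x
      = C Complex.I * (C (sz x j) * numB ε x - C (sMinus x j) * numA ε x) := by
  refine polynomial_ext_off ε fun l hl => ?_
  have hj := sub_ne_zero.mpr (hl j)
  simp only [velB, numA, numB, eval_mul, eval_sub, eval_X, eval_C, numer_eval ε _ _ l hl,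
    sub_div, Finset.sum_sub_distrib, mul_div_assoc, ← Finset.mul_sum,
    spinVel, sum_poisson_spinHamiltonian_div ε hε j x _ l hl, poisson_spinHamiltonian_fst]
  have e1 : ∑ k, spinCross x j k 0 / (l - ε k) - Complex.I * ∑ k, spinCross x j k 1 / (l - ε k)
      = -Complex.I * (sz x j * ∑ k, sMinus x k / (l - ε k)
        - sMinus x j * ∑ k, sz x k / (l - ε k)) := by
    simp only [Finset.mul_sum, ← Finset.sum_sub_distrib]
    refine Finset.sum_congr rfl fun k _ => ?_
    simp [spinCross, sMinus, sz]
    linear_combination ((x.2 j 1 * x.2 k 2 - x.2 j 2 * x.2 k 1) / (l - ε k)) * Complex.I_sq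
  have e2 : fieldTorque ε x j 0 - Complex.I * fieldTorque ε x j 1
      = 2 * Complex.I * (x.1 * sz x j - ε j * sMinus x j) := by
    simp [fieldTorque, sMinus, sz]
    linear_combination (-2 * ε j * x.2 j 1 : ℂ) * Complex.I_sq
  field_simp
  simp
  linear_combination (∏ k, (l - ε k)) * (e2 - e1)

theorem lax_velA (ε : Fin n → ℝ) (hε : Function.Injective ε) (j : Fin n) (x : Phase n) :
    (X - C (ε j : ℂ)) * velA ε (spinHamiltonian ε j) x
      = C (Complex.I / 2) * (C (sMinus x j) * numC ε x - C (sPlus x j) * numB ε x) := by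
  refine polynomial_ext_off ε fun l hl => ?_
  have hj := sub_ne_zero.mpr (hl j)
  simp only [velA, numB, numC, eval_mul, eval_sub, eval_X, eval_C, eval_zero,
    numer_eval ε _ _ l hl, spinVel, sum_poisson_spinHamiltonian_div ε hε j x _ l hl]
  have e1 : ∑ k, spinCross x j k 2 / (l - ε k)
      = -(Complex.I / 2) * (sMinus x j * ∑ k, sPlus x k / (l - ε k)
        - sPlus x j * ∑ k, sMinus x k / (l - ε k)) := by
    simp only [Finset.mul_sum, ← Finset.sum_sub_distrib]
    refine Finset.sum_congr rfl fun k _ => ?_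
    simp [spinCross, sMinus, sPlus]
    linear_combination ((x.2 j 0 * x.2 k 1 - x.2 j 1 * x.2 k 0) / (l - ε k)) * Complex.I_sq
  have e2 : fieldTorque ε x j 2
      = Complex.I * (bbar x * sMinus x j - x.1 * sPlus x j) := by
    simp [fieldTorque, sMinus, sPlus]
    linear_combination ((x.1 + bbar x) * x.2 j 1) * Complex.I_sq
  field_simp
  linear_combination (∏ k, (l - ε k)) * 2 * (e2 - e1)

theorem velC_numberHamiltonian (ε : Fin n → ℝ) (x : Phase n) :
    velC ε numberHamiltonian x = C Complex.I * numC ε x := by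
  refine polynomial_ext_off ε fun l hl => ?_
  simp only [velC, numC, eval_mul, eval_C, numer_eval ε _ _ l hl, spinVel,
    poisson_numberHamiltonian_fst, poisson_numberHamiltonian_spin]
  have e : ∀ k, ![-(x.2 k 1 : ℂ), (x.2 k 0 : ℂ), 0] 0
      + Complex.I * ![-(x.2 k 1 : ℂ), (x.2 k 0 : ℂ), 0] 1 = Complex.I * sPlus x k := by
    intro k
    simp [sPlus]
    linear_combination (-(x.2 k 1 : ℂ)) * Complex.I_sq
  simp only [e, mul_div_assoc, ← Finset.mul_sum]
  simp [bbar]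
  ring

theorem velB_numberHamiltonian (ε : Fin n → ℝ) (x : Phase n) :
    velB ε numberHamiltonian x = C (-Complex.I) * numB ε x := by
  refine polynomial_ext_off ε fun l hl => ?_
  simp only [velB, numB, eval_mul, eval_C, numer_eval ε _ _ l hl, spinVel,
    poisson_numberHamiltonian_fst, poisson_numberHamiltonian_spin]
  have e : ∀ k, ![-(x.2 k 1 : ℂ), (x.2 k 0 : ℂ), 0] 0
      - Complex.I * ![-(x.2 k 1 : ℂ), (x.2 k 0 : ℂ), 0] 1 = -Complex.I * sMinus x k := by
    intro k
    simp [sMinus]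
    linear_combination (-(x.2 k 1 : ℂ)) * Complex.I_sq
  simp only [e, mul_div_assoc, ← Finset.mul_sum]
  ring

theorem velA_numberHamiltonian (ε : Fin n → ℝ) (x : Phase n) :
    velA ε numberHamiltonian x = 0 := by
  simp [velA, numer, spinVel, poisson_numberHamiltonian_spin]

@[simp] theorem hamiltonian_castSucc (ε : Fin n → ℝ) (j : Fin n) :
    hamiltonian ε j.castSucc = spinHamiltonian ε j := by
  simp [hamiltonian]

@[simp] theorem hamiltonian_last (ε : Fin n → ℝ) :
    hamiltonian ε (Fin.last n) = numberHamiltonian := by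
  simp [hamiltonian]

/-- The trace of the square of the Lax matrix is conserved. -/
theorem velocity_spectralPoly (ε : Fin n → ℝ) (hε : Function.Injective ε) (i : Fin (n + 1))
    (x : Phase n) :
    2 * numA ε x * velA ε (hamiltonian ε i) x + velB ε (hamiltonian ε i) x * numC ε x
      + numB ε x * velC ε (hamiltonian ε i) x = 0 := by
  induction i using Fin.lastCases with
  | last =>
    rw [hamiltonian_last, velA_numberHamiltonian, velB_numberHamiltonian, velC_numberHamiltonian,
      C_neg]
    ring
  | cast j =>
    rw [hamiltonian_castSucc]
    refine (mul_eq_zero.mp ?_).resolve_left (X_sub_C_ne_zero (ε j : ℂ))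
    have h2 : (2 : ℂ[X]) * C (Complex.I / 2) = C Complex.I := by
      rw [← C_ofNat, ← C_mul]
      congr 1
      ring
    linear_combination 2 * numA ε x * lax_velA ε hε j x + numC ε x * lax_velB ε hε j x
      + numB ε x * lax_velC ε hε j x
      + numA ε x * (C (sMinus x j) * numC ε x - C (sPlus x j) * numB ε x) * h2

/-! ### Time derivatives along a trajectory -/

theorem hasDerivAt_numer_eval (ε : Fin n → ℝ) {w : ℝ → ℂ} {r : Fin n → ℝ → ℂ} {l : ℝ → ℂ}
    {w' : ℂ} {r' : Fin n → ℂ} {l' : ℂ} {t : ℝ} (p : ℂ[X]) (hw : HasDerivAt w w' t)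
    (hr : ∀ j, HasDerivAt (r j) (r' j) t) (hl : HasDerivAt l l' t) :
    HasDerivAt (fun τ => (numer ε (p + C (w τ)) (fun j => r j τ)).eval (l τ))
      ((numer ε (C w') r').eval (l t)
        + (derivative (numer ε (p + C (w t)) (fun j => r j t))).eval (l t) * l') t := by
  have hq : ∀ q : ℂ[X], HasDerivAt (fun τ => q.eval (l τ)) ((derivative q).eval (l t) * l') t :=
    fun q => (q.hasDerivAt (l t)).comp t hl
  have h := ((hq (p * poleProd ε)).add (hw.mul (hq (poleProd ε)))).add
    (HasDerivAt.fun_sum (u := Finset.univ) fun j _ => (hr j).mul (hq (poleProdErase ε j)))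
  refine (h.congr_deriv ?_).congr_of_eventuallyEq (Eventually.of_forall fun τ => ?_)
  · simp only [numer, eval_add, eval_mul, eval_C, eval_finsetSum, derivative_add, derivative_mul,
      derivative_sum, derivative_C, Finset.sum_add_distrib, add_mul, Finset.sum_mul, zero_mul,
      zero_add]
    simp only [mul_assoc]
    ring
  · simp [numer, eval_finsetSum]
    ring

section trajectory
variable {H : Phase n → ℂ} {x : ℝ → Phase n} {J : Set ℝ} {t : ℝ}

theorem IsHamiltonianTrajectory.hasDerivAt_bbar (hx : IsHamiltonianTrajectory H x J) (ht : t ∈ J) :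
    HasDerivAt (fun τ => bbar (x τ)) ((starRingEnd ℂ) (poisson H (fun z => z.1) (x t))) t :=
  (hx t ht).1.star

theorem IsHamiltonianTrajectory.hasDerivAt_numA (hx : IsHamiltonianTrajectory H x J) (ht : t ∈ J)
    (ε : Fin n → ℝ) {l : ℝ → ℂ} {l' : ℂ} (hl : HasDerivAt l l' t) :
    HasDerivAt (fun τ => (numA ε (x τ)).eval (l τ))
      ((velA ε H (x t)).eval (l t) + (derivative (numA ε (x t))).eval (l t) * l') t := by
  have h := hasDerivAt_numer_eval ε (2 * X) (hasDerivAt_const t (0 : ℂ))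
    (fun k => (hx t ht).2 k 2) hl
  simp only [map_zero, add_zero] at h
  exact h

theorem IsHamiltonianTrajectory.hasDerivAt_numB (hx : IsHamiltonianTrajectory H x J) (ht : t ∈ J)
    (ε : Fin n → ℝ) {l : ℝ → ℂ} {l' : ℂ} (hl : HasDerivAt l l' t) :
    HasDerivAt (fun τ => (numB ε (x τ)).eval (l τ))
      ((velB ε H (x t)).eval (l t) + (derivative (numB ε (x t))).eval (l t) * l') t := by
  have h := hasDerivAt_numer_eval ε 0 ((hx t ht).1.const_mul 2)
    (fun k => ((hx t ht).2 k 0).sub (((hx t ht).2 k 1).const_mul Complex.I)) hl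
  simp only [zero_add] at h
  exact h

theorem IsHamiltonianTrajectory.hasDerivAt_numC (hx : IsHamiltonianTrajectory H x J) (ht : t ∈ J)
    (ε : Fin n → ℝ) {l : ℝ → ℂ} {l' : ℂ} (hl : HasDerivAt l l' t) :
    HasDerivAt (fun τ => (numC ε (x τ)).eval (l τ))
      ((velC ε H (x t)).eval (l t) + (derivative (numC ε (x t))).eval (l t) * l') t := by
  have h := hasDerivAt_numer_eval ε 0 ((hx.hasDerivAt_bbar ht).const_mul 2)
    (fun k => ((hx t ht).2 k 0).add (((hx t ht).2 k 1).const_mul Complex.I)) hl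
  simp only [zero_add] at h
  exact h

/-- The spectral curve does not move: the Lax equation. -/
theorem spectralPoly_const (ε : Fin n → ℝ) (hε : Function.Injective ε) (i : Fin (n + 1))
    (hJ : IsOpen J) (hJc : J.OrdConnected) (hx : IsHamiltonianTrajectory (hamiltonian ε i) x J)
    {t₀ t₁ : ℝ} (h₀ : t₀ ∈ J) (h₁ : t₁ ∈ J) :
    spectralPoly ε (x t₀) = spectralPoly ε (x t₁) := by
  refine Polynomial.funext fun l => ?_
  have hd : ∀ t ∈ J, HasDerivAt (fun τ => (spectralPoly ε (x τ)).eval l) 0 t := by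
    intro t ht
    have hl := hasDerivAt_const t l
    have h := ((hx.hasDerivAt_numA ht ε hl).pow 2).add
      ((hx.hasDerivAt_numB ht ε hl).mul (hx.hasDerivAt_numC ht ε hl))
    have e := congrArg (eval l) (velocity_spectralPoly ε hε i (x t))
    simp only [eval_add, eval_mul, eval_ofNat, eval_zero] at e
    refine (h.congr_deriv ?_).congr_of_eventuallyEq (Eventually.of_forall fun τ => ?_)
    · simp only [mul_zero, add_zero]
      linear_combination e
    · simp [spectralPoly_eq]
  exact hJ.is_const_of_deriv_eq_zero hJc.isPreconnected
    (fun t ht => (hd t ht).differentiableAt.differentiableWithinAt) (fun t ht => (hd t ht).deriv)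
    h₀ h₁
end trajectory

/-! ### Degrees and values of the numerators -/

theorem numer_natDegree_le (ε : Fin n → ℝ) (w : ℂ) (r : Fin n → ℂ) :
    (numer ε (C w) r).natDegree ≤ n := by
  refine natDegree_add_le_of_degree_le (natDegree_C_mul_le _ _ |>.trans ?_)
    (natDegree_sum_le_of_forall_le _ _ fun j _ => (natDegree_C_mul_le _ _).trans ?_)
  · refine (natDegree_prod_le _ _).trans ?_
    simp
  · refine (natDegree_prod_le _ _).trans ?_
    simp

theorem numer_eval_pole (ε : Fin n → ℝ) (p : ℂ[X]) (r : Fin n → ℂ) (j : Fin n) :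
    (numer ε p r).eval (ε j : ℂ) = r j * (poleProdErase ε j).eval (ε j : ℂ) := by
  simp only [numer, eval_add, eval_mul, eval_finsetSum, eval_C]
  rw [Finset.sum_eq_single j]
  · simp [poleProd, eval_prod, Finset.prod_eq_zero (Finset.mem_univ j)]
  · intro k _ hk
    simp [poleProdErase, eval_prod,
      Finset.prod_eq_zero (Finset.mem_erase.mpr ⟨hk.symm, Finset.mem_univ j⟩)]
  · simp

theorem natDegree_spectralPoly (ε : Fin n → ℝ) (x : Phase n) :
    (spectralPoly ε x).natDegree = 2 * n + 2 := by
  have hP : (poleProd ε).Monic := monic_prod_of_monic _ _ fun k _ => monic_X_sub_C _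
  have hPd : (poleProd ε).natDegree = n := by
    rw [poleProd, natDegree_prod_of_monic _ _ fun k _ => monic_X_sub_C _]
    simp
  have h1 : (2 * X * poleProd ε).natDegree = n + 1 := by
    have h2 : (2 * X * poleProd ε : ℂ[X]) = C 2 * (X * poleProd ε) := by
      rw [C_ofNat, mul_assoc]
    rw [h2, natDegree_C_mul two_ne_zero, natDegree_X_mul hP.ne_zero, hPd]
  have hA : (numA ε x).natDegree = n + 1 := by
    rw [numA, numer, natDegree_add_eq_left_of_natDegree_lt, h1]
    rw [h1, Nat.lt_succ_iff]
    have := numer_natDegree_le ε 0 (sz x)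
    simpa [numer] using this
  rw [spectralPoly_eq, natDegree_add_eq_left_of_natDegree_lt]
  · rw [natDegree_pow, hA]
    ring
  · rw [natDegree_pow, hA]
    have h3 := numer_natDegree_le ε (2 * x.1) (sMinus x)
    have h4 := numer_natDegree_le ε (2 * bbar x) (sPlus x)
    refine lt_of_le_of_lt natDegree_mul_le ?_
    rw [numB, numC]
    omega

/-! ### Poles of the eigenvector -/

/-- Through every point of the curve there is a branch of the square root of `Q`, defined
everywhere, continuous at that point, and analytic there unless it is a branch point. -/
theorem exists_sqrt_branch {Q : ℂ[X]} {p : ℂ × ℂ} (hp : p ∈ curve Q) :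
    ∃ r : ℂ → ℂ, (∀ l, r l ^ 2 = Q.eval l) ∧ ContinuousAt r p.1 ∧ r p.1 = p.2 ∧
      (p.2 ≠ 0 → AnalyticAt ℂ r p.1) := by
  have hp' : p.2 ^ 2 = Q.eval p.1 := hp
  have hsq : ∀ z : ℂ, (z ^ ((2 : ℕ) : ℂ)⁻¹) ^ 2 = z := fun z =>
    Complex.cpow_nat_inv_pow z two_ne_zero
  by_cases hy : p.2 = 0
  · refine ⟨fun l => (Q.eval l) ^ ((2 : ℕ) : ℂ)⁻¹, fun l => hsq _, ?_, ?_, fun h => absurd hy h⟩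
    · refine ContinuousAt.comp (g := fun z : ℂ => z ^ ((2 : ℕ) : ℂ)⁻¹) ?_ Q.continuous.continuousAt
      rw [← hp', hy]
      exact Complex.continuousAt_cpow_const_of_re_pos (by simp) (by simp)
    · simp [← hp', hy]
  · have hA : AnalyticAt ℂ (fun l => p.2 * (Q.eval l / p.2 ^ 2) ^ ((2 : ℕ) : ℂ)⁻¹) p.1 := by
      refine analyticAt_const.mul (AnalyticAt.cpow ?_ analyticAt_const ?_)
      · exact ((AnalyticOnNhd.eval_polynomial Q) p.1 (Set.mem_univ _)).div analyticAt_const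
          (pow_ne_zero 2 hy)
      · rw [← hp', div_self (pow_ne_zero 2 hy)]
        exact Complex.one_mem_slitPlane
    refine ⟨_, fun l => ?_, hA.continuousAt, ?_, fun _ => hA⟩
    · rw [mul_pow, hsq]
      field_simp
    · simp only [← hp', div_self (pow_ne_zero 2 hy), Complex.one_cpow, mul_one]

theorem psi_eq (ε : Fin n → ℝ) (x : Phase n) (l y : ℂ) (hl : ∀ j, l ≠ ε j) :
    psi ε x l (y / ∏ j, (l - (ε j : ℂ))) = ((numA ε x).eval l + y) / (numC ε x).eval l := by
  have hP : ∏ j, (l - (ε j : ℂ)) ≠ 0 :=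
    Finset.prod_ne_zero_iff.mpr fun j _ => sub_ne_zero.mpr (hl j)
  have hA : (numA ε x).eval l = (∏ j, (l - (ε j : ℂ))) * laxA ε x l := by
    simp [numA, numer_eval ε _ _ l hl, laxA]
  have hC : (numC ε x).eval l = (∏ j, (l - (ε j : ℂ))) * laxC ε x l := by
    simp [numC, numer_eval ε _ _ l hl, laxC]
  rw [psi, hA, hC]
  by_cases h : laxC ε x l = 0
  · simp [h]
  · field_simp

/-- At a pole of the eigenvector the numerator of `C` vanishes and `y` is the value of the numerator
of `A`; on the other sheet `(a + y) / c = b / (y - a)` stays finite. The curve has no isolated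
points, so that the limit in the definition of a pole is not vacuous. -/
theorem IsPole.numC_ne_zero_and {ε : Fin n → ℝ} {x : Phase n} {p : ℂ × ℂ} (h : IsPole ε x p) :
    numC ε x ≠ 0 ∧ (numC ε x).eval p.1 = 0 ∧ p.2 = (numA ε x).eval p.1 := by
  obtain ⟨hp, hlim⟩ := h
  obtain ⟨r, hr, hrc, hrp, -⟩ := exists_sqrt_branch hp
  have hmap : Tendsto (fun l => (l, r l)) (𝓝[≠] p.1) (𝓝[curve (spectralPoly ε x) \ {p}] p) := by
    refine tendsto_nhdsWithin_iff.mpr ⟨?_, ?_⟩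
    · have : ContinuousAt (fun l => (l, r l)) p.1 := continuousAt_id.prodMk hrc
      have h2 := this.tendsto
      rw [hrp] at h2
      exact h2.mono_left nhdsWithin_le_nhds
    · filter_upwards [self_mem_nhdsWithin] with l hl
      exact ⟨hr l, fun e => hl (congrArg Prod.fst e)⟩
  have hoff : ∀ᶠ l in 𝓝[≠] p.1, ∀ j, l ≠ (ε j : ℂ) := by
    refine eventually_all.mpr fun j => ?_
    by_cases hj : p.1 = ε j
    · filter_upwards [self_mem_nhdsWithin] with l hl
      exact hj ▸ hl
    · exact nhdsWithin_le_nhds (isOpen_ne.mem_nhds hj)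
  have hlim' : Tendsto (fun l => ‖((numA ε x).eval l + r l) / (numC ε x).eval l‖)
      (𝓝[≠] p.1) atTop := by
    refine (hlim.comp hmap).congr' ?_
    filter_upwards [hoff] with l hl
    simp only [Function.comp_apply, psi_eq ε x l (r l) hl]
  -- a function bounded by one which has a finite limit at `p` is not a pole
  have hbdd : ∀ g : ℂ → ℂ, ContinuousAt g p.1 →
      ¬ ∀ᶠ l in 𝓝[≠] p.1, ‖((numA ε x).eval l + r l) / (numC ε x).eval l‖ ≤ ‖g l‖ := by
    intro g hg hle
    have h1 := tendsto_atTop_mono' _ hle hlim'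
    exact not_tendsto_nhds_of_tendsto_atTop h1 _ (hg.norm.tendsto.mono_left nhdsWithin_le_nhds)
  have hc0 : numC ε x ≠ 0 := by
    intro h0
    refine hbdd 0 continuousAt_const (Eventually.of_forall fun l => ?_)
    simp [h0]
  have hcr : (numC ε x).eval p.1 = 0 := by
    by_contra hne
    exact hbdd (fun l => ((numA ε x).eval l + r l) / (numC ε x).eval l)
      (((numA ε x).continuousAt.add hrc).div (numC ε x).continuousAt hne)
      (Eventually.of_forall fun l => le_rfl)
  refine ⟨hc0, hcr, ?_⟩
  by_contra hne
  have hd : r p.1 - (numA ε x).eval p.1 ≠ 0 := by rwa [hrp, sub_ne_zero]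
  have hdc : ContinuousAt (fun l => r l - (numA ε x).eval l) p.1 := hrc.sub (numA ε x).continuousAt
  -- on the other sheet `(a + y) / c = b / (y - a)` is finite
  refine hbdd (fun l => (numB ε x).eval l / (r l - (numA ε x).eval l))
      ((numB ε x).continuousAt.div hdc hd) ?_
  filter_upwards [(hdc.eventually_ne hd).filter_mono nhdsWithin_le_nhds] with l hl
  by_cases hcl : (numC ε x).eval l = 0
  · simp only [hcl, div_zero, norm_zero]
    exact norm_nonneg _
  · refine le_of_eq (congrArg _ ?_)
    rw [div_eq_div_iff hcl hl]
    have := hr l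
    simp only [spectralPoly_eq, eval_add, eval_mul, eval_pow] at this
    linear_combination this

/-! ### Motion of the separated variables -/

theorem eval_poleProdErase_self_ne_zero {ε : Fin n → ℝ} (hε : Function.Injective ε) (j : Fin n) :
    (poleProdErase ε j).eval (ε j : ℂ) ≠ 0 := by
  simp only [poleProdErase, eval_prod, eval_sub, eval_X, eval_C]
  refine Finset.prod_ne_zero_iff.mpr fun k hk => sub_ne_zero.mpr fun h => ?_
  exact Finset.ne_of_mem_erase hk (hε (by exact_mod_cast h)).symm

theorem eval_poleProdErase_of_ne (ε : Fin n → ℝ) {j k : Fin n} (hk : k ≠ j) :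
    (poleProdErase ε j).eval (ε k : ℂ) = 0 := by
  simp only [poleProdErase, eval_prod, eval_sub, eval_X, eval_C]
  exact Finset.prod_eq_zero (Finset.mem_erase.mpr ⟨hk, Finset.mem_univ k⟩) (sub_self _)

theorem poleProdErase_degree_lt (ε : Fin n → ℝ) (j : Fin n) :
    (poleProdErase ε j).degree < n := by
  rw [poleProdErase, degree_prod]
  simp only [degree_X_sub_C, Finset.sum_const, Finset.card_erase_of_mem (Finset.mem_univ j),
    Finset.card_univ, Fintype.card_fin, nsmul_eq_mul, mul_one]
  have := j.pos
  exact_mod_cast (by omega : n - 1 < n)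

/-- A polynomial of degree at most `n` with `n` distinct roots splits off its leading coefficient. -/
theorem eq_C_mul_prod_of_roots {c : ℂ[X]} (hc : c ≠ 0) (hd : c.natDegree ≤ n) {l : Fin n → ℂ}
    (hl : Function.Injective l) (h0 : ∀ k, c.eval (l k) = 0) :
    ∃ κ : ℂ, κ ≠ 0 ∧ c = C κ * ∏ k, (X - C (l k)) := by
  obtain ⟨q, hq⟩ : (∏ k, (X - C (l k))) ∣ c :=
    Finset.prod_dvd_of_coprime
      (fun a _ b _ hab => pairwise_coprime_X_sub_C hl hab)
      fun k _ => dvd_iff_isRoot.mpr (h0 k)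
  have hq0 : q ≠ 0 := by
    rintro rfl
    exact hc (by rw [hq, mul_zero])
  have hm : (∏ k, (X - C (l k))).Monic := monic_prod_of_monic _ _ fun k _ => monic_X_sub_C _
  have hdeg : q.natDegree = 0 := by
    have h1 := hm.natDegree_mul' hq0
    rw [← hq, natDegree_prod_of_monic _ _ fun k _ => monic_X_sub_C _] at h1
    simp only [natDegree_X_sub_C, Finset.sum_const, Finset.card_univ, Fintype.card_fin,
      smul_eq_mul, mul_one] at h1
    omega
  obtain ⟨κ, rfl⟩ := natDegree_eq_zero.mp hdeg
  exact ⟨κ, fun h => hq0 (by rw [h, C_0]), by rw [hq, mul_comm]⟩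

/-- The Lax equation at a zero `m` of `c = (X - m) d`, in the flow of `H_j`. The two formulas have no
denominator `m - ε_j`, and thus cover the case that the zero sits at `ε_j`, where `s_j^+ = 0`. -/
theorem vel_at_root_spinHamiltonian {ε : Fin n → ℝ} (hε : Function.Injective ε) (j : Fin n)
    (x : Phase n) {m : ℂ} {d : ℂ[X]} (hd : numC ε x = (X - C m) * d) :
    (velC ε (spinHamiltonian ε j) x).eval m
        = -Complex.I * (d.eval (ε j : ℂ) / (poleProdErase ε j).eval (ε j : ℂ))
          * (numA ε x).eval m ∧
      (velA ε (spinHamiltonian ε j) x).eval m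
        = Complex.I / 2 * (d.eval (ε j : ℂ) / (poleProdErase ε j).eval (ε j : ℂ))
          * (numB ε x).eval m := by
  have hπ := eval_poleProdErase_self_ne_zero hε j
  have hC := lax_velC ε hε j x
  have hA := lax_velA ε hε j x
  have hs := numer_eval_pole ε (C (2 * bbar x)) (sPlus x) j
  change (numC ε x).eval _ = _ at hs
  by_cases hm : m = ε j
  · have hs0 : sPlus x j = 0 := by
      rw [hd, hm] at hs
      simpa [hπ] using hs.symm
    have ha := numer_eval_pole ε (2 * X) (sz x) j
    have hb := numer_eval_pole ε (C (2 * x.1)) (sMinus x) j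
    change (numA ε x).eval _ = _ at ha
    change (numB ε x).eval _ = _ at hb
    rw [hd, hs0, ← hm] at hC hA
    have hC' : velC ε (spinHamiltonian ε j) x = C Complex.I * (-(C (sz x j) * d)) := by
      refine mul_left_cancel₀ (X_sub_C_ne_zero m) (hC.trans ?_)
      rw [C_0]
      ring
    have hA' : velA ε (spinHamiltonian ε j) x = C (Complex.I / 2) * (C (sMinus x j) * d) := by
      refine mul_left_cancel₀ (X_sub_C_ne_zero m) (hA.trans ?_)
      rw [C_0]
      ring
    rw [hC', hA', hm, ha, hb]
    simp only [eval_mul, eval_C, eval_neg]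
    constructor <;> field_simp
  · have hm' : m - (ε j : ℂ) ≠ 0 := sub_ne_zero.mpr hm
    have hsd : sPlus x j * (poleProdErase ε j).eval (ε j : ℂ) = (ε j - m) * d.eval (ε j : ℂ) := by
      rw [← hs, hd]
      simp
    have hc0 : (numC ε x).eval m = 0 := by simp [hd]
    have hC' := congrArg (eval m) hC
    have hA' := congrArg (eval m) hA
    simp only [eval_mul, eval_sub, eval_X, eval_C, hc0] at hC' hA'
    have hsd' : sPlus x j
        = (ε j - m) * (d.eval (ε j : ℂ) / (poleProdErase ε j).eval (ε j : ℂ)) := by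
      rw [← mul_div_assoc, eq_div_iff hπ, hsd]
    exact ⟨mul_left_cancel₀ hm' (by linear_combination hC' + Complex.I * (numA ε x).eval m * hsd'),
      mul_left_cancel₀ hm'
        (by linear_combination hA' - Complex.I / 2 * (numB ε x).eval m * hsd')⟩

/-- The value of the differential `dl / y` on the velocity of the `k`-th separated variable in the
flow with index `i`, as a function of the coordinates `l` of the separated variables. -/
def separatedSpeed (ε : Fin n → ℝ) (i : Fin (n + 1)) (l : Fin n → ℂ) (k : Fin n) : ℂ :=
  Fin.lastCases (motive := fun _ => ℂ) 0
    (fun j => Complex.I * (∏ r ∈ Finset.univ.erase k, ((ε j : ℂ) - l r) / (l k - l r))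
      / (poleProdErase ε j).eval (ε j : ℂ)) i

/-- Lagrange interpolation of `∏_{m ≠ j} (X - ε_m)` at the nodes `l k`, evaluated at the `ε_m`. -/
theorem sum_eval_poleProdErase_mul_separatedSpeed {ε : Fin n → ℝ} (hε : Function.Injective ε)
    (i : Fin (n + 1)) {l : Fin n → ℂ} (hl : Function.Injective l) (j : Fin n) :
    ∑ k, (poleProdErase ε j).eval (l k) * separatedSpeed ε i l k
      = if i = j.castSucc then Complex.I else 0 := by
  induction i using Fin.lastCases with
  | last => simp [separatedSpeed, (Fin.castSucc_lt_last j).ne']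
  | cast m =>
    have hπ := eval_poleProdErase_self_ne_zero hε m
    have h := Lagrange.eq_interpolate (s := Finset.univ) (v := l) (f := poleProdErase ε j)
      hl.injOn (by simpa using poleProdErase_degree_lt ε j)
    have h' := congrArg (eval (ε m : ℂ)) h
    rw [Lagrange.interpolate_apply, eval_finsetSum] at h'
    have hk : ∀ k, (poleProdErase ε j).eval (l k) * separatedSpeed ε m.castSucc l k
        = (C (eval (l k) (poleProdErase ε j)) * Lagrange.basis Finset.univ l k).eval (ε m : ℂ)
          * (Complex.I / (poleProdErase ε m).eval (ε m : ℂ)) := by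
      intro k
      simp only [separatedSpeed, Fin.lastCases_castSucc, Lagrange.basis, Lagrange.basisDivisor,
        eval_mul, eval_C, eval_prod, eval_sub, eval_X]
      have : ∀ r, ((ε m : ℂ) - l r) / (l k - l r) = (l k - l r)⁻¹ * (ε m - l r) := fun r => by
        rw [div_eq_inv_mul]
      simp only [this]
      ring
    rw [Finset.sum_congr rfl fun k _ => hk k, ← Finset.sum_mul, ← h']
    by_cases hmj : m = j
    · subst hmj
      simp only [if_true]
      field_simp
    · rw [eval_poleProdErase_of_ne ε hmj, zero_mul, if_neg]
      exact fun e => hmj (Fin.castSucc_injective n e)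

theorem hasDerivAt_mul_of_eq_zero {f g : ℝ → ℂ} {f' : ℂ} {t : ℝ} (hf : HasDerivAt f f' t)
    (h0 : f t = 0) (hg : ContinuousAt g t) : HasDerivAt (fun τ => f τ * g τ) (f' * g t) t := by
  rw [hasDerivAt_iff_tendsto_slope] at hf ⊢
  refine (hf.mul (hg.tendsto.mono_left nhdsWithin_le_nhds)).congr fun τ => ?_
  simp only [slope_def_module, h0, zero_mul, sub_zero, smul_mul_assoc]

/-- A continuous simple zero of the moving polynomial `numC` is differentiable. -/
theorem IsHamiltonianTrajectory.hasDerivAt_root {H : Phase n → ℂ} {x : ℝ → Phase n} {J : Set ℝ}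
    {t : ℝ} (hx : IsHamiltonianTrajectory H x J) (ht : t ∈ J) (ε : Fin n → ℝ) {l : ℝ → ℂ}
    (hl : ContinuousAt l t) (h0 : ∀ᶠ τ in 𝓝 t, (numC ε (x τ)).eval (l τ) = 0)
    (h1 : (derivative (numC ε (x t))).eval (l t) ≠ 0) :
    HasDerivAt l (-(velC ε H (x t)).eval (l t) / (derivative (numC ε (x t))).eval (l t)) t := by
  -- the increment of the coefficients, evaluated at the moving zero
  have hD : HasDerivAt (fun τ => (numC ε (x τ)).eval (l τ) - (numC ε (x t)).eval (l τ))
      ((velC ε H (x t)).eval (l t)) t := by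
    have hb := ((hx.hasDerivAt_bbar ht).const_mul 2).sub_const (2 * bbar (x t))
    have hs : ∀ k, HasDerivAt (fun τ => sPlus (x τ) k - sPlus (x t) k)
        (spinVel H (x t) 0 k + Complex.I * spinVel H (x t) 1 k) t := fun k =>
      (((hx t ht).2 k 0).add (((hx t ht).2 k 1).const_mul Complex.I)).sub_const _
    have hq : ∀ q : ℂ[X], ContinuousAt (fun τ => q.eval (l τ)) t := fun q =>
      ContinuousAt.comp (g := fun z => q.eval z) q.continuous.continuousAt hl
    have h := (hasDerivAt_mul_of_eq_zero hb (sub_self _) (hq (poleProd ε))).add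
      (HasDerivAt.fun_sum (u := Finset.univ) fun k _ =>
        hasDerivAt_mul_of_eq_zero (hs k) (sub_self _) (hq (poleProdErase ε k)))
    refine (h.congr_deriv ?_).congr_of_eventuallyEq (Eventually.of_forall fun τ => ?_)
    · simp [velC, numer, eval_finsetSum]
    · simp [numC, numer, eval_finsetSum, sub_mul, Finset.sum_sub_distrib]
      ring
  set q : ℂ → ℂ := dslope (fun z => (numC ε (x t)).eval z) (l t) with hq
  have hqt : q (l t) = (derivative (numC ε (x t))).eval (l t) := by
    rw [hq, dslope_same, Polynomial.deriv]
  have hqc : ContinuousAt (fun τ => q (l τ)) t :=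
    ContinuousAt.comp (g := q) (continuousAt_dslope_same.mpr (numC ε (x t)).differentiableAt) hl
  have hqi : ContinuousAt (fun τ => (q (l τ))⁻¹) t := hqc.inv₀ (by rwa [hqt])
  have hprod := (hasDerivAt_mul_of_eq_zero hD (sub_self _) hqi).neg.add_const (l t)
  refine (hprod.congr_deriv ?_).congr_of_eventuallyEq ?_
  · rw [hqt]
    ring
  · have h0t := h0.self_of_nhds
    filter_upwards [h0, hqc.eventually_ne (by rwa [hqt])] with τ hτ hne
    have hsub := sub_smul_dslope (fun z => (numC ε (x t)).eval z) (l t) (l τ)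
    simp only [smul_eq_mul, h0t, sub_zero] at hsub
    rw [← hq] at hsub
    simp only [Pi.neg_apply, hτ, zero_sub, ← hsub]
    field_simp
    ring

/-- The separated variables move along the curve with the speed `separatedSpeed`, measured by
the differential `dl / y`. The velocity is given in a form that makes sense at branch points. -/
theorem hasDerivAt_separated {ε : Fin n → ℝ} (hε : Function.Injective ε) {i : Fin (n + 1)}
    {J : Set ℝ} (hJ : IsOpen J) {x : ℝ → Phase n}
    (hx : IsHamiltonianTrajectory (hamiltonian ε i) x J)
    {p : Fin n → ℝ → ℂ × ℂ} (hpc : ∀ k, ContinuousOn (p k) J)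
    (hpole : ∀ t ∈ J, ∀ k, IsPole ε (x t) (p k t))
    {t : ℝ} (ht : t ∈ J) (hl : Function.Injective fun k => (p k t).1) (k : Fin n) :
    HasDerivAt (p k)
      ((p k t).2 * separatedSpeed ε i (fun r => (p r t).1) k,
        (derivative (spectralPoly ε (x t))).eval (p k t).1 / 2
          * separatedSpeed ε i (fun r => (p r t).1) k) t := by
  obtain ⟨hc0, hck, hyk⟩ := (hpole t ht k).numC_ne_zero_and
  obtain ⟨κ, hκ, hfac⟩ := eq_C_mul_prod_of_roots hc0 (numer_natDegree_le ε _ _) hl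
    fun r => (hpole t ht r).numC_ne_zero_and.2.1
  set d : ℂ[X] := C κ * ∏ r ∈ Finset.univ.erase k, (X - C (p r t).1) with hd
  have hcd : numC ε (x t) = (X - C (p k t).1) * d := by
    rw [hfac, ← Finset.mul_prod_erase _ _ (Finset.mem_univ k), hd]
    ring
  have hder : (derivative (numC ε (x t))).eval (p k t).1 = d.eval (p k t).1 := by
    rw [hcd]
    simp
  have hdk : d.eval (p k t).1 ≠ 0 := by
    simp only [hd, eval_mul, eval_C, eval_prod, eval_sub, eval_X]
    refine mul_ne_zero hκ (Finset.prod_ne_zero_iff.mpr fun r hr => sub_ne_zero.mpr fun e => ?_)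
    exact Finset.ne_of_mem_erase hr (hl e).symm
  have hJt : J ∈ 𝓝 t := hJ.mem_nhds ht
  have hlc : ContinuousAt (fun τ => (p k τ).1) t := ((hpc k).continuousAt hJt).fst
  have hroot := hx.hasDerivAt_root ht ε hlc
    (by filter_upwards [hJt] with τ hτ using (hpole τ hτ k).numC_ne_zero_and.2.1)
    (by rwa [hder])
  have hy : HasDerivAt (fun τ => (p k τ).2) _ t :=
    (hx.hasDerivAt_numA ht ε hroot).congr_of_eventuallyEq
      (by filter_upwards [hJt] with τ hτ using (hpole τ hτ k).numC_ne_zero_and.2.2)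
  set w := separatedSpeed ε i (fun r => (p r t).1) k with hw
  -- the Lax equation, in terms of `w`
  have hvel : (velC ε (hamiltonian ε i) (x t)).eval (p k t).1
        = -(w * d.eval (p k t).1 * (numA ε (x t)).eval (p k t).1) ∧
      (velA ε (hamiltonian ε i) (x t)).eval (p k t).1
        = w * d.eval (p k t).1 / 2 * (numB ε (x t)).eval (p k t).1 := by
    clear_value w
    induction i using Fin.lastCases with
    | last =>
      have : w = 0 := by simp [hw, separatedSpeed]
      rw [this, hamiltonian_last, velA_numberHamiltonian, velC_numberHamiltonian]
      simp [hck]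
    | cast j =>
      have : w * d.eval (p k t).1 = Complex.I *
          (d.eval (ε j : ℂ) / (poleProdErase ε j).eval (ε j : ℂ)) := by
        have h1 : ∏ r ∈ Finset.univ.erase k, ((p k t).1 - (p r t).1) ≠ 0 := by
          refine Finset.prod_ne_zero_iff.mpr fun r hr => sub_ne_zero.mpr fun e => ?_
          exact Finset.ne_of_mem_erase hr (hl e).symm
        have h2 := eval_poleProdErase_self_ne_zero hε j
        simp only [hw, separatedSpeed, Fin.lastCases_castSucc, hd, eval_mul, eval_C, eval_prod,
          eval_sub, eval_X, Finset.prod_div_distrib]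
        field_simp
      obtain ⟨e1, e2⟩ := vel_at_root_spinHamiltonian hε j (x t) hcd
      rw [hamiltonian_castSucc, e1, e2, this]
      constructor <;> ring
  have hQ' : (derivative (spectralPoly ε (x t))).eval (p k t).1
      = 2 * (numA ε (x t)).eval (p k t).1 * (derivative (numA ε (x t))).eval (p k t).1
        + (numB ε (x t)).eval (p k t).1 * d.eval (p k t).1 := by
    rw [spectralPoly_eq]
    simp only [derivative_add, derivative_mul, derivative_pow, eval_add, eval_mul, hck, hder]
    simp
  refine (hroot.prodMk hy).congr_deriv (Prod.ext ?_ ?_)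
  · simp only
    rw [hvel.1, hder, hyk]
    field_simp
  · simp only
    rw [hvel.1, hvel.2, hder, hQ']
    field_simp
    ring

/-- The value of `f dl / y` on a tangent vector with speed `w`. -/
theorem formValue_of_speed {Q : ℂ[X]} (hQ : Squarefree Q) (f : ℂ × ℂ → ℂ) {p : ℂ × ℂ}
    (hp : p ∈ curve Q) (w : ℂ) :
    formValue Q f p (p.2 * w, (derivative Q).eval p.1 / 2 * w) = f p * w := by
  rw [formValue, dlOverY]
  congr 1
  split_ifs with h
  · have hp' : p.2 ^ 2 = Q.eval p.1 := hp
    have hQ0 : Q.eval p.1 = 0 := by rw [← hp', h]; simp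
    have hd : (derivative Q).eval p.1 ≠ 0 :=
      (PerfectField.separable_iff_squarefree.mpr hQ).eval₂_derivative_ne_zero (RingHom.id ℂ) hQ0
    simp only
    field_simp
  · simp only
    field_simp

/-! ### The holomorphic differentials of the curve -/

/-- Liouville's theorem with polynomial growth: an entire function which is `O(l ^ (n - 1))` at
infinity is a polynomial of degree less than `n`. -/
theorem exists_polynomial_of_growth {g : ℂ → ℂ} (hg : Differentiable ℂ g) {K R : ℝ}
    (h : ∀ l, R ≤ ‖l‖ → ‖g l‖ * ‖l‖ ≤ K * ‖l‖ ^ n) :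
    ∃ P : ℂ[X], P.degree < n ∧ ∀ l, g l = P.eval l := by
  induction n generalizing g K R with
  | zero =>
    refine ⟨0, by simp, fun l => ?_⟩
    rw [eval_zero]
    refine hg.apply_eq_of_tendsto_cocompact l ?_
    have h1 : Tendsto (fun l : ℂ => K * ‖l‖⁻¹) (cocompact ℂ) (𝓝 0) := by
      simpa using (tendsto_inv_atTop_zero.comp (tendsto_norm_cocompact_atTop (E := ℂ))).const_mul K
    refine squeeze_zero_norm' ?_ h1
    filter_upwards [(tendsto_norm_cocompact_atTop (E := ℂ)).eventually_ge_atTop (max R 1)]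
      with l hl
    have hl0 : 0 < ‖l‖ := lt_of_lt_of_le one_pos ((le_max_right _ _).trans hl)
    rw [← div_eq_mul_inv, le_div_iff₀ hl0]
    simpa using h l ((le_max_left _ _).trans hl)
  | succ n ih =>
    have hd : Differentiable ℂ (dslope g 0) := by
      rw [← differentiableOn_univ] at hg ⊢
      exact (Complex.differentiableOn_dslope univ_mem).mpr hg
    obtain ⟨P, hP, hPe⟩ := ih hd (K := K + ‖g 0‖) (R := max R 1) fun l hl => by
      have hl1 : 1 ≤ ‖l‖ := (le_max_right _ _).trans hl
      have hl0 : 0 < ‖l‖ := lt_of_lt_of_le one_pos hl1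
      have e := sub_smul_dslope g 0 l
      rw [sub_zero, smul_eq_mul] at e
      have h1 : ‖g l‖ ≤ K * ‖l‖ ^ n := by
        have := h l ((le_max_left _ _).trans hl)
        rw [pow_succ, ← mul_assoc] at this
        exact le_of_mul_le_mul_right this hl0
      calc ‖dslope g 0 l‖ * ‖l‖ = ‖g l - g 0‖ := by rw [← e, norm_mul, mul_comm]
        _ ≤ ‖g l‖ + ‖g 0‖ := norm_sub_le _ _
        _ ≤ K * ‖l‖ ^ n + ‖g 0‖ * ‖l‖ ^ n :=
            add_le_add h1 (le_mul_of_one_le_right (norm_nonneg _) (one_le_pow₀ hl1))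
        _ = (K + ‖g 0‖) * ‖l‖ ^ n := by ring
    refine ⟨C (g 0) + X * P, ?_, fun l => ?_⟩
    · refine (degree_add_le _ _).trans_lt (max_lt (degree_C_le.trans_lt ?_) ?_)
      · exact_mod_cast Nat.succ_pos n
      · by_cases hP0 : P = 0
        · rw [hP0, mul_zero, degree_zero]
          exact WithBot.bot_lt_coe _
        · rw [degree_mul, degree_X, degree_eq_natDegree hP0] at *
          have : P.natDegree < n := by exact_mod_cast hP
          exact_mod_cast (by omega : 1 + P.natDegree < n + 1)
    · have e := sub_smul_dslope g 0 l
      rw [sub_zero, smul_eq_mul] at e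
      simp only [eval_add, eval_C, eval_mul, eval_X, ← hPe, e]
      ring

/-- `f` is, near every point of the curve, the restriction of a holomorphic function. -/
def HolomorphicOnCurve (Q : ℂ[X]) (f : ℂ × ℂ → ℂ) : Prop :=
  ∀ p ∈ curve Q, ∃ F : ℂ × ℂ → ℂ, AnalyticAt ℂ F p ∧ ∀ᶠ q in 𝓝[curve Q] p, f q = F q

theorem neg_mem_curve {Q : ℂ[X]} {p : ℂ × ℂ} (hp : p ∈ curve Q) : (p.1, -p.2) ∈ curve Q := by
  simpa [curve] using hp

theorem HolomorphicOnCurve.involution {Q : ℂ[X]} {f : ℂ × ℂ → ℂ} (hf : HolomorphicOnCurve Q f) :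
    HolomorphicOnCurve Q fun q => f (q.1, -q.2) := by
  intro p hp
  obtain ⟨F, hF, hFe⟩ := hf _ (neg_mem_curve hp)
  have hι : AnalyticAt ℂ (fun q : ℂ × ℂ => (q.1, -q.2)) p := analyticAt_fst.prod analyticAt_snd.neg
  refine ⟨fun q => F (q.1, -q.2),
    AnalyticAt.fun_comp (g := F) (f := fun q : ℂ × ℂ => (q.1, -q.2)) hF hι, ?_⟩
  have ht : Tendsto (fun q : ℂ × ℂ => (q.1, -q.2)) (𝓝[curve Q] p) (𝓝[curve Q] (p.1, -p.2)) :=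
    hι.continuousAt.continuousWithinAt.tendsto_nhdsWithin fun q hq => neg_mem_curve hq
  exact ht.eventually hFe

/-- A holomorphic function on the curve which only depends on `l` is an entire function of `l`:
off the branch points a branch of `y` is analytic, and the branch points are removable. -/
theorem HolomorphicOnCurve.differentiable {Q : ℂ[X]} (hQ : Q ≠ 0) {f : ℂ × ℂ → ℂ}
    (hf : HolomorphicOnCurve Q f) {g : ℂ → ℂ} (hg : ∀ p ∈ curve Q, f p = g p.1) :
    Differentiable ℂ g := by
  have key : ∀ p ∈ curve Q, ContinuousAt g p.1 ∧ (p.2 ≠ 0 → DifferentiableAt ℂ g p.1) := by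
    intro p hp
    obtain ⟨r, hr, hrc, hrp, hra⟩ := exists_sqrt_branch hp
    obtain ⟨F, hF, hFe⟩ := hf p hp
    have hc : ContinuousAt (fun l => (l, r l)) p.1 := continuousAt_id.prodMk hrc
    have hpt : (p.1, r p.1) = p := by rw [hrp]
    have ht : Tendsto (fun l => (l, r l)) (𝓝 p.1) (𝓝[curve Q] p) := by
      refine tendsto_nhdsWithin_iff.mpr ⟨?_, Eventually.of_forall hr⟩
      have := hc.tendsto
      rwa [hpt] at this
    have he : g =ᶠ[𝓝 p.1] fun l => F (l, r l) := by
      filter_upwards [ht.eventually hFe] with l hl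
      rw [← hl, hg (l, r l) (hr l)]
    refine ⟨?_, fun hy => ?_⟩
    · refine ContinuousAt.congr ?_ he.symm
      exact ContinuousAt.comp (g := F) (by rw [hpt]; exact hF.continuousAt) hc
    · refine DifferentiableAt.congr_of_eventuallyEq ?_ he
      exact (AnalyticAt.fun_comp (g := F) (f := fun l => (l, r l)) (by rw [hpt]; exact hF)
        (analyticAt_id.prod (hra hy))).differentiableAt
  have hex : ∀ l, ∃ y, (l, y) ∈ curve Q := fun l => IsAlgClosed.exists_pow_nat_eq (Q.eval l) two_pos
  intro l
  obtain ⟨y, hy⟩ := hex l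
  refine (Complex.analyticAt_of_differentiable_on_punctured_nhds_of_continuousAt ?_
    (key _ hy).1).differentiableAt
  have hfin : ∀ᶠ z in 𝓝[≠] l, Q.eval z ≠ 0 := by
    by_cases hl : Q.eval l = 0
    · have hA : AnalyticAt ℂ (fun z => Q.eval z) l :=
        AnalyticOnNhd.eval_polynomial Q l (Set.mem_univ _)
      refine hA.eventually_eq_zero_or_eventually_ne_zero.resolve_left fun h => hQ ?_
      refine eq_of_infinite_eval_eq Q 0 (Set.Infinite.mono (fun z hz => ?_)
        (infinite_of_mem_nhds l h))
      simpa using hz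
    · exact nhdsWithin_le_nhds (Q.continuous.continuousAt.eventually_ne hl)
  filter_upwards [hfin] with z hz
  obtain ⟨v, hv⟩ := hex z
  refine (key _ hv).2 fun h0 => hz ?_
  have hv' : v ^ 2 = Q.eval z := hv
  rw [← hv', show v = 0 from h0]
  simp

/-- The order of growth at the two points at infinity of the function `f` of a holomorphic
differential `f dl / y`, and of the function `y`. -/
theorem growth_of_mem_holomorphicDifferentials {Q : ℂ[X]} (hdeg : Q.natDegree = 2 * n + 2)
    {f : ℂ × ℂ → ℂ} (hf : f ∈ holomorphicDifferentials n Q) :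
    ∃ K R : ℝ, 0 ≤ K ∧ ∀ p ∈ curve Q, R ≤ ‖p.1‖ →
      ‖f p‖ * ‖p.1‖ ≤ K * ‖p.1‖ ^ n ∧ ‖p.2‖ ≤ K * ‖p.1‖ ^ (n + 1) := by
  obtain ⟨-, -, hinf⟩ := hf
  have hloc : ∀ w₀ : ℂ, w₀ ^ 2 = Q.coeff (2 * n + 2) → ∃ δ > 0, ∃ K : ℝ, 0 ≤ K ∧
      ∀ u v : ℂ, ‖u‖ < δ → ‖v - w₀‖ < δ → u ≠ 0 → (1 / u, v / u ^ (n + 1)) ∈ curve Q →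
        ‖f (1 / u, v / u ^ (n + 1))‖ * ‖u‖ ^ n ≤ ‖u‖ * K := by
    intro w₀ hw
    obtain ⟨F, hF, hFe⟩ := hinf w₀ hw
    have hb : ∀ᶠ q in 𝓝 ((0 : ℂ), w₀), ‖F q‖ < ‖F (0, w₀)‖ + 1 :=
      hF.continuousAt.norm.eventually_lt continuousAt_const (by linarith)
    obtain ⟨δ, hδ, h⟩ := Metric.eventually_nhds_iff.mp (hFe.and hb)
    refine ⟨δ, hδ, ‖F (0, w₀)‖ + 1, by positivity, fun u v hu hv hu0 hc => ?_⟩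
    obtain ⟨h1, h2⟩ := h (y := (u, v)) (by
      rw [Prod.dist_eq, max_lt_iff, dist_eq_norm, dist_eq_norm, sub_zero]
      exact ⟨hu, hv⟩)
    rw [← norm_pow, ← norm_mul, h1 hu0 hc, norm_mul]
    exact mul_le_mul_of_nonneg_left h2.le (norm_nonneg _)
  obtain ⟨w, hw⟩ : ∃ w : ℂ, w ^ 2 = Q.coeff (2 * n + 2) :=
    IsAlgClosed.exists_pow_nat_eq _ two_pos
  obtain ⟨δ₁, hδ₁, K₁, hK₁, h₁⟩ := hloc w hw
  obtain ⟨δ₂, hδ₂, K₂, hK₂, h₂⟩ := hloc (-w) (by rw [neg_sq, hw])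
  set δ := min δ₁ δ₂ with hδdef
  have hδ : 0 < δ := lt_min hδ₁ hδ₂
  have hrev : ∀ᶠ u in 𝓝 (0 : ℂ), ‖Q.reverse.eval u - w ^ 2‖ < δ ^ 2 := by
    have hc : ContinuousAt (fun u => ‖Q.reverse.eval u - w ^ 2‖) 0 :=
      (Q.reverse.continuous.continuousAt.sub continuousAt_const).norm
    refine hc.eventually_lt continuousAt_const ?_
    rw [← coeff_zero_eq_eval_zero, coeff_zero_reverse, leadingCoeff, hdeg, hw, sub_self, norm_zero]
    positivity
  obtain ⟨ρ, hρ, hρ'⟩ := Metric.eventually_nhds_iff.mp hrev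
  have hm : 0 < min δ ρ := lt_min hδ hρ
  refine ⟨K₁ + K₂ + (‖w‖ + δ), (min δ ρ)⁻¹ + 1, by positivity, fun p hp hR => ?_⟩
  have hp1 : 0 < ‖p.1‖ := lt_of_lt_of_le (by positivity) hR
  have hp0 : p.1 ≠ 0 := norm_pos_iff.mp hp1
  set u := p.1⁻¹ with hu
  set v := p.2 * u ^ (n + 1) with hv
  have hu0 : u ≠ 0 := inv_ne_zero hp0
  have hun : ‖u‖ < min δ ρ := by
    rw [hu, norm_inv]
    exact inv_lt_of_inv_lt₀ hm (by linarith)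
  have hpt : (1 / u, v / u ^ (n + 1)) = p := by
    refine Prod.ext ?_ ?_
    · simp [hu]
    · simp only [hv]
      field_simp
  have hv2 : v ^ 2 = Q.reverse.eval u := by
    have hp' : p.2 ^ 2 = Q.eval p.1 := hp
    let _ := invertibleOfNonzero hp0
    have e := eval₂_reverse_mul_pow (RingHom.id ℂ) p.1 Q
    rw [invOf_eq_inv, eval₂_id, eval₂_id, hdeg] at e
    have h1 : p.1 ^ (2 * n + 2) * (u ^ (n + 1)) ^ 2 = 1 := by
      rw [← pow_mul, show (n + 1) * 2 = 2 * n + 2 by ring, ← mul_pow, hu, mul_inv_cancel₀ hp0,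
        one_pow]
    rw [hv, mul_pow, hp', ← e, ← hu, mul_assoc, h1, mul_one]
  have hclose : ‖v - w‖ * ‖v - -w‖ < δ * δ := by
    have := hρ' (y := u) (by rw [dist_zero_right]; exact hun.trans_le (min_le_right _ _))
    rw [← hv2, show v ^ 2 - w ^ 2 = (v - w) * (v - -w) by ring, norm_mul] at this
    rwa [sq] at this
  have hpu : ‖p.1‖ * ‖u‖ = 1 := by rw [← norm_mul, hu, mul_inv_cancel₀ hp0, norm_one]
  have fin : ∀ w₀ : ℂ, ∀ K : ℝ, K ≤ K₁ + K₂ → ‖w₀‖ = ‖w‖ → ‖v - w₀‖ < δ →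
      ‖f p‖ * ‖u‖ ^ n ≤ ‖u‖ * K →
      ‖f p‖ * ‖p.1‖ ≤ (K₁ + K₂ + (‖w‖ + δ)) * ‖p.1‖ ^ n ∧
        ‖p.2‖ ≤ (K₁ + K₂ + (‖w‖ + δ)) * ‖p.1‖ ^ (n + 1) := by
    intro w₀ K hK hw₀ hvw hb
    have hpn : ‖p.1‖ ^ n * ‖u‖ ^ n = 1 := by rw [← mul_pow, hpu, one_pow]
    constructor
    · calc ‖f p‖ * ‖p.1‖ = ‖p.1‖ ^ n * ‖p.1‖ * (‖f p‖ * ‖u‖ ^ n) := by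
            linear_combination (-‖f p‖ * ‖p.1‖) * hpn
        _ ≤ ‖p.1‖ ^ n * ‖p.1‖ * (‖u‖ * K) := mul_le_mul_of_nonneg_left hb (by positivity)
        _ = K * ‖p.1‖ ^ n := by linear_combination K * ‖p.1‖ ^ n * hpu
        _ ≤ _ := mul_le_mul_of_nonneg_right
            (by have := norm_nonneg w; linarith) (by positivity)
    · have hvn : ‖v‖ ≤ ‖w‖ + δ := by
        have := norm_add_le (v - w₀) w₀
        rw [sub_add_cancel, hw₀] at this
        linarith
      calc ‖p.2‖ = ‖v‖ * ‖p.1‖ ^ (n + 1) := by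
            rw [hv, norm_mul, norm_pow, mul_assoc, ← mul_pow, mul_comm ‖u‖, hpu, one_pow, mul_one]
        _ ≤ _ := mul_le_mul_of_nonneg_right (by linarith) (by positivity)
  have hu₁ : ‖u‖ < δ₁ := hun.trans_le ((min_le_left _ _).trans (min_le_left _ _))
  have hu₂ : ‖u‖ < δ₂ := hun.trans_le ((min_le_left _ _).trans (min_le_right _ _))
  by_cases hcase : ‖v - w‖ < δ
  · refine fin w K₁ (by linarith) rfl hcase ?_
    have := h₁ u v hu₁ (hcase.trans_le (min_le_left _ _)) hu0 (by rwa [hpt])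
    rwa [hpt] at this
  · have hcase' : ‖v - -w‖ < δ := by
      by_contra hn
      exact absurd hclose (not_lt.mpr (mul_le_mul (not_lt.mp hcase) (not_lt.mp hn) hδ.le
        (norm_nonneg _)))
    refine fin (-w) K₂ (by linarith) (norm_neg w) hcase' ?_
    have := h₂ u v hu₂ (hcase'.trans_le (min_le_right _ _)) hu0 (by rwa [hpt])
    rwa [hpt] at this

/-- Every holomorphic differential is `P(l) dl / y` with a polynomial `P` of degree less than `n`.
The even part of `f` under the hyperelliptic involution is such a polynomial; the odd part,
times `y`, is a polynomial of degree at most `2 n` which vanishes at the `2 n + 2` branch points. -/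
theorem exists_polynomial_of_mem_holomorphicDifferentials {Q : ℂ[X]}
    (hdeg : Q.natDegree = 2 * n + 2) (hsq : Squarefree Q) {f : ℂ × ℂ → ℂ}
    (hf : f ∈ holomorphicDifferentials n Q) :
    ∃ P : ℂ[X], P.degree < n ∧ ∀ q ∈ curve Q, f q = P.eval q.1 := by
  have hQ0 : Q ≠ 0 := hsq.ne_zero
  have hhol : HolomorphicOnCurve Q f := hf.2.1
  obtain ⟨K, R, hK, hgrow⟩ := growth_of_mem_holomorphicDifferentials hdeg hf
  choose r hr using fun l => IsAlgClosed.exists_pow_nat_eq (Q.eval l) two_pos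
  have hcases : ∀ p ∈ curve Q, p.2 = r p.1 ∨ p.2 = -r p.1 := fun p hp =>
    sq_eq_sq_iff_eq_or_eq_neg.mp ((show p.2 ^ 2 = _ from hp).trans (hr p.1).symm)
  have hrm : ∀ l, (l, r l) ∈ curve Q := hr
  have hrm' : ∀ l, (l, -r l) ∈ curve Q := fun l => neg_mem_curve (hrm l)
  obtain ⟨P, hP, hPe⟩ : ∃ P : ℂ[X], P.degree < n ∧ ∀ l, f (l, r l) + f (l, -r l) = P.eval l := by
    refine exists_polynomial_of_growth (g := fun l => f (l, r l) + f (l, -r l)) (K := 2 * K)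
      (R := R) ?_ fun l hl => ?_
    · refine HolomorphicOnCurve.differentiable hQ0 (f := fun q => f q + f (q.1, -q.2)) ?_ ?_
      · intro p hp
        obtain ⟨F, hF, hFe⟩ := hhol p hp
        obtain ⟨G, hG, hGe⟩ := hhol.involution p hp
        refine ⟨F + G, hF.add hG, ?_⟩
        filter_upwards [hFe, hGe] with q h1 h2
        simp [h1, h2]
      · rintro ⟨l, y⟩ hp
        rcases hcases _ hp with h | h <;> simp only at h <;> subst h
        · rfl
        · simp only [neg_neg]
          exact add_comm _ _
    · have h1 := (hgrow _ (hrm l) hl).1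
      have h2 := (hgrow _ (hrm' l) hl).1
      have h3 := mul_le_mul_of_nonneg_right (norm_add_le (f (l, r l)) (f (l, -r l)))
        (norm_nonneg l)
      simp only at h1 h2
      linarith
  obtain ⟨S, hS, hSe⟩ : ∃ S : ℂ[X], S.degree < (2 * n + 1 : ℕ) ∧
      ∀ l, (f (l, r l) - f (l, -r l)) * r l = S.eval l := by
    refine exists_polynomial_of_growth (g := fun l => (f (l, r l) - f (l, -r l)) * r l)
      (K := 2 * K * K) (R := R) ?_ fun l hl => ?_
    · refine HolomorphicOnCurve.differentiable hQ0
        (f := fun q => (f q - f (q.1, -q.2)) * q.2) ?_ ?_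
      · intro p hp
        obtain ⟨F, hF, hFe⟩ := hhol p hp
        obtain ⟨G, hG, hGe⟩ := hhol.involution p hp
        refine ⟨fun q => (F q - G q) * q.2, (hF.sub hG).mul analyticAt_snd, ?_⟩
        filter_upwards [hFe, hGe] with q h1 h2
        rw [h1, h2]
      · rintro ⟨l, y⟩ hp
        rcases hcases _ hp with h | h <;> simp only at h <;> subst h
        · rfl
        · simp only [neg_neg]
          ring
    · obtain ⟨h1, hy⟩ := hgrow _ (hrm l) hl
      have h2 := (hgrow _ (hrm' l) hl).1
      have h3 := mul_le_mul_of_nonneg_right (norm_sub_le (f (l, r l)) (f (l, -r l)))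
        (norm_nonneg l)
      simp only at h1 h2 hy
      calc ‖(f (l, r l) - f (l, -r l)) * r l‖ * ‖l‖
          = ‖f (l, r l) - f (l, -r l)‖ * ‖l‖ * ‖r l‖ := by rw [norm_mul]; ring
        _ ≤ (2 * K * ‖l‖ ^ n) * (K * ‖l‖ ^ (n + 1)) :=
            mul_le_mul (by linarith) hy (norm_nonneg _) (by positivity)
        _ = 2 * K * K * ‖l‖ ^ (2 * n + 1) := by ring
  have hS0 : S = 0 := by
    have hcard : Q.roots.toFinset.card = 2 * n + 2 := by
      rw [Multiset.toFinset_card_of_nodup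
        (nodup_roots (PerfectField.separable_iff_squarefree.mpr hsq)),
        IsAlgClosed.card_roots_eq_natDegree, hdeg]
    refine eq_zero_of_degree_lt_of_eval_finset_eq_zero Q.roots.toFinset
      (hS.trans (by rw [hcard]; exact_mod_cast Nat.lt_succ_self _)) fun l hl => ?_
    have hl0 : Q.eval l = 0 := (mem_roots hQ0).mp (Multiset.mem_toFinset.mp hl)
    rw [← hSe, (pow_eq_zero_iff two_ne_zero).mp ((hr l).trans hl0), mul_zero]
  have heq : ∀ l, f (l, r l) = f (l, -r l) := by
    intro l
    by_cases h : r l = 0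
    · rw [h, neg_zero]
    · have := hSe l
      rw [hS0, eval_zero] at this
      exact sub_eq_zero.mp ((mul_eq_zero.mp this).resolve_right h)
  refine ⟨C (1 / 2) * P, by rwa [degree_C_mul (by norm_num)], ?_⟩
  rintro ⟨l, y⟩ hp
  have e := hPe l
  rw [eval_mul, eval_C, ← e]
  rcases hcases _ hp with h | h <;> simp only at h <;> subst h
  · rw [heq]
    ring
  · rw [heq]
    ring

/-- The differential `P(l) dl / y` with a polynomial `P`. -/
def polyDifferential (Q P : ℂ[X]) : ℂ × ℂ → ℂ :=
  open Classical in fun q => if q ∈ curve Q then P.eval q.1 else 0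

theorem polyDifferential_of_mem {Q : ℂ[X]} (P : ℂ[X]) {q : ℂ × ℂ} (hq : q ∈ curve Q) :
    polyDifferential Q P q = P.eval q.1 := if_pos hq

theorem polyDifferential_mem (Q : ℂ[X]) {P : ℂ[X]} (hP : P.degree < n) :
    polyDifferential Q P ∈ holomorphicDifferentials n Q := by
  have hA : ∀ (S : ℂ[X]) (q : ℂ × ℂ), AnalyticAt ℂ (fun q : ℂ × ℂ => S.eval q.1) q := fun S q =>
    AnalyticAt.fun_comp (g := fun z => S.eval z)
      (AnalyticOnNhd.eval_polynomial S q.1 (Set.mem_univ _)) analyticAt_fst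
  refine ⟨fun q hq => if_neg hq, fun q _ => ⟨fun q => P.eval q.1, hA P q, ?_⟩, fun w _ => ?_⟩
  · filter_upwards [self_mem_nhdsWithin] with q hq using if_pos hq
  · refine ⟨fun q => (P.reflect (n - 1)).eval q.1, hA _ _, Eventually.of_forall fun q h0 hc => ?_⟩
    rw [polyDifferential_of_mem P hc]
    by_cases hP0 : P = 0
    · simp [hP0]
    have hnd : P.natDegree < n := (natDegree_lt_iff_degree_lt hP0).mpr hP
    let _ := invertibleOfNonzero (one_div_ne_zero h0)
    have e := eval₂_reflect_mul_pow (RingHom.id ℂ) (1 / q.1) (n - 1) P (by omega)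
    rw [invOf_eq_inv, eval₂_id, eval₂_id, one_div, inv_inv] at e
    rw [one_div, ← e, inv_pow]
    obtain ⟨m, rfl⟩ : ∃ m, n = m + 1 := ⟨n - 1, by omega⟩
    simp only [Nat.add_sub_cancel, pow_succ]
    field_simp

theorem exists_basis_holomorphicDifferentials {ε : Fin n → ℝ} (hε : Function.Injective ε)
    {Q : ℂ[X]} (hdeg : Q.natDegree = 2 * n + 2) (hsq : Squarefree Q) :
    ∃ σ : Module.Basis (Fin n) ℂ (holomorphicDifferentials n Q),
      ∀ j, (σ j : ℂ × ℂ → ℂ) = polyDifferential Q (poleProdErase ε j) := by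
  let v : Fin n → holomorphicDifferentials n Q := fun j =>
    ⟨polyDifferential Q (poleProdErase ε j), polyDifferential_mem Q (poleProdErase_degree_lt ε j)⟩
  have hsum : ∀ (a : Fin n → ℂ) (q : ℂ × ℂ), q ∈ curve Q →
      ((∑ j, a j • v j : holomorphicDifferentials n Q) : ℂ × ℂ → ℂ) q
        = ∑ j, a j * (poleProdErase ε j).eval q.1 := by
    intro a q hq
    simp [v, Finset.sum_apply, polyDifferential_of_mem _ hq]
  have hpt : ∀ l : ℂ, ∃ y, (l, y) ∈ curve Q := fun l =>
    IsAlgClosed.exists_pow_nat_eq (Q.eval l) two_pos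
  have hval : ∀ (a : Fin n → ℂ) (k : Fin n), ∑ j, a j * (poleProdErase ε j).eval (ε k : ℂ)
      = a k * (poleProdErase ε k).eval (ε k : ℂ) := by
    intro a k
    refine Finset.sum_eq_single k (fun j _ hj => ?_) (by simp)
    rw [eval_poleProdErase_of_ne ε hj.symm, mul_zero]
  have hli : LinearIndependent ℂ v := by
    rw [Fintype.linearIndependent_iff]
    intro a ha k
    obtain ⟨y, hy⟩ := hpt (ε k)
    have h := hsum a _ hy
    rw [ha, hval] at h
    exact (mul_eq_zero.mp h.symm).resolve_right (eval_poleProdErase_self_ne_zero hε k)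
  have hspan : ⊤ ≤ Submodule.span ℂ (Set.range v) := by
    rintro ⟨f, hf⟩ -
    obtain ⟨P, hP, hPe⟩ := exists_polynomial_of_mem_holomorphicDifferentials hdeg hsq hf
    set a : Fin n → ℂ := fun j => P.eval (ε j : ℂ) / (poleProdErase ε j).eval (ε j : ℂ) with ha
    have hPsum : P = ∑ j, C (a j) * poleProdErase ε j := by
      refine eq_of_degrees_lt_of_eval_index_eq Finset.univ (v := fun k => (ε k : ℂ))
        (fun k _ l _ h => hε (Complex.ofReal_injective h)) (by simpa using hP) ?_ fun k _ => ?_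
      · rw [Finset.card_univ, Fintype.card_fin]
        refine (degree_sum_le _ _).trans_lt ((Finset.sup_lt_iff (WithBot.bot_lt_coe n)).mpr
          fun j _ => by
          rw [← smul_eq_C_mul]
          exact (degree_smul_le _ _).trans_lt (poleProdErase_degree_lt ε j))
      · rw [eval_finsetSum]
        simp only [eval_mul, eval_C]
        rw [hval, ha, div_mul_cancel₀ _ (eval_poleProdErase_self_ne_zero hε k)]
    have hfe : (⟨f, hf⟩ : holomorphicDifferentials n Q) = ∑ j, a j • v j := by
      refine Subtype.ext (funext fun q => ?_)
      by_cases hq : q ∈ curve Q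
      · change f q = _
        rw [hsum a q hq, hPe q hq, hPsum, eval_finsetSum]
        simp only [eval_mul, eval_C]
      · rw [(∑ j, a j • v j : holomorphicDifferentials n Q).2.1 q hq]
        exact hf.1 q hq
    rw [hfe]
    exact Submodule.sum_mem _ fun j _ =>
      Submodule.smul_mem _ _ (Submodule.subset_span (Set.mem_range_self j))
  exact ⟨Module.Basis.mk hli hspan, fun j => by rw [Module.Basis.mk_apply]⟩

/-! ### Paths, periods and the Abel map -/

section paths
variable {Q : ℂ[X]} {m : ℕ} {η : Fin m → ℂ × ℂ → ℂ}

theorem PathIntegral.trans {p q r : ℂ × ℂ} {v w : Fin m → ℂ} (h : PathIntegral Q η p q v)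
    (h' : PathIntegral Q η q r w) : PathIntegral Q η p r (v + w) := by
  induction h' with
  | nil _ => rwa [add_zero]
  | snoc w γ _ hγ ih =>
    have := PathIntegral.snoc p _ γ ih hγ
    convert this using 1
    funext j
    simp only [Pi.add_apply]
    ring

theorem formValue_neg (f : ℂ × ℂ → ℂ) (p v : ℂ × ℂ) :
    formValue Q f p (-v) = -formValue Q f p v := by
  rw [formValue, formValue, dlOverY, dlOverY]
  split_ifs
  · simp only [Prod.snd_neg]
    ring
  · simp only [Prod.fst_neg]
    ring

theorem IsArc.reverse {γ : ℝ → ℂ × ℂ} (hγ : IsArc Q γ) : IsArc Q fun τ => γ (1 - τ) := by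
  have hm : Set.MapsTo (fun τ : ℝ => 1 - τ) (Set.Icc 0 1) (Set.Icc 0 1) := fun τ hτ =>
    ⟨by linarith [hτ.2], by linarith [hτ.1]⟩
  exact ⟨hγ.1.comp (contDiff_const.sub contDiff_id).contDiffOn hm, hγ.2.comp hm⟩

theorem arcIntegral_reverse (f : ℂ × ℂ → ℂ) (γ : ℝ → ℂ × ℂ) :
    arcIntegral Q f (fun τ => γ (1 - τ)) = -arcIntegral Q f γ := by
  have hd : ∀ τ, derivWithin (fun τ => γ (1 - τ)) (Set.Icc 0 1) τ
      = -derivWithin γ (Set.Icc 0 1) (1 - τ) := by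
    intro τ
    rw [derivWithin_comp_const_sub]
    simp
  simp only [arcIntegral, hd, formValue_neg, intervalIntegral.integral_neg]
  rw [intervalIntegral.integral_comp_sub_left
    (fun τ => formValue Q f (γ τ) (derivWithin γ (Set.Icc 0 1) τ))]
  simp

theorem PathIntegral.reverse {p q : ℂ × ℂ} {v : Fin m → ℂ} (h : PathIntegral Q η p q v) :
    PathIntegral Q η q p (-v) := by
  induction h with
  | nil hp => simpa using PathIntegral.nil p hp
  | snoc v γ _ hγ ih =>
    have h1 : γ 1 ∈ curve Q := hγ.2 (Set.right_mem_Icc.mpr zero_le_one)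
    have h2 := PathIntegral.snoc (η := η) (γ 1) 0 (fun τ => γ (1 - τ))
      (by simpa using PathIntegral.nil (η := η) (γ 1) h1) hγ.reverse
    simp only [sub_self] at h2
    convert h2.trans ih using 1
    funext j
    simp only [Pi.neg_apply, Pi.add_apply, Pi.zero_apply, arcIntegral_reverse]
    ring

/-- If a path from `q k` to `q' k` yields the integrals `w k`, then the Abel map changes by the sum
of the `w k`: two paths with the same end points differ by a closed path. -/
theorem IsAbelImage.eq_add {N : ℕ} {p₀ q q' : Fin N → ℂ × ℂ} {u u' : Jacobian Q η}
    (hu : IsAbelImage Q η p₀ q u) (hu' : IsAbelImage Q η p₀ q' u') {w : Fin N → Fin m → ℂ}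
    (hw : ∀ k, PathIntegral Q η (q k) (q' k) (w k)) :
    u' = u + QuotientAddGroup.mk (∑ k, w k) := by
  obtain ⟨v, hv, rfl⟩ := hu
  obtain ⟨v', hv', rfl⟩ := hu'
  rw [← QuotientAddGroup.mk_add, QuotientAddGroup.eq, ← Finset.sum_add_distrib,
    ← Finset.sum_neg_distrib, ← Finset.sum_add_distrib]
  refine AddSubgroup.sum_mem _ fun k _ => AddSubgroup.subset_closure ⟨q' k, ?_⟩
  exact (hv' k).reverse.trans ((hv k).trans (hw k))
end paths

theorem HolomorphicOnCurve.continuousOn {Q : ℂ[X]} {f : ℂ × ℂ → ℂ} (hf : HolomorphicOnCurve Q f) :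
    ContinuousOn f (curve Q) := by
  intro p hp
  obtain ⟨F, hF, hFe⟩ := hf p hp
  exact hF.continuousAt.continuousWithinAt.congr_of_eventuallyEq hFe (hFe.self_of_nhdsWithin hp)

theorem continuousOn_separatedSpeed (ε : Fin n → ℝ) (i : Fin (n + 1)) {l : Fin n → ℝ → ℂ}
    {J : Set ℝ} (hl : ∀ k, ContinuousOn (l k) J)
    (hinj : ∀ t ∈ J, Function.Injective fun k => l k t) (k : Fin n) :
    ContinuousOn (fun t => separatedSpeed ε i (fun r => l r t) k) J := by
  induction i using Fin.lastCases with
  | last =>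
    simp only [separatedSpeed, Fin.lastCases_last]
    exact continuousOn_const
  | cast j =>
    simp only [separatedSpeed, Fin.lastCases_castSucc]
    refine (continuousOn_const.mul (continuousOn_finsetProd _ fun r hr => ?_)).div_const _
    refine (continuousOn_const.sub (hl r)).div ((hl k).sub (hl r)) fun t ht => ?_
    exact sub_ne_zero.mpr fun e => Finset.ne_of_mem_erase hr (hinj t ht e).symm

theorem mapsTo_segment {J : Set ℝ} (hJc : J.OrdConnected) {t₀ t₁ : ℝ} (h₀ : t₀ ∈ J)
    (h₁ : t₁ ∈ J) : Set.MapsTo (fun τ : ℝ => t₀ + τ * (t₁ - t₀)) (Set.Icc 0 1) J := by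
  intro τ hτ
  have h := hJc.convex h₀ h₁ (sub_nonneg.mpr hτ.2) hτ.1 (by ring)
  simp only [smul_eq_mul] at h
  convert h using 1
  ring

/-- A moving point whose velocity has continuous speed `w` with respect to `dl / y` runs through
`C¹` arcs, along which the integral of `f dl / y` is the time integral of `f w`. -/
theorem isArc_and_arcIntegral_of_speed {Q : ℂ[X]} (hQ : Squarefree Q) {J : Set ℝ} (hJ : IsOpen J)
    (hJc : J.OrdConnected) {p : ℝ → ℂ × ℂ} {w : ℝ → ℂ} (hp : ∀ t ∈ J, p t ∈ curve Q)
    (hw : ContinuousOn w J)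
    (hd : ∀ t ∈ J, HasDerivAt p ((p t).2 * w t, (derivative Q).eval (p t).1 / 2 * w t) t)
    {t₀ t₁ : ℝ} (h₀ : t₀ ∈ J) (h₁ : t₁ ∈ J) :
    IsArc Q (fun τ => p (t₀ + τ * (t₁ - t₀))) ∧ ∀ f : ℂ × ℂ → ℂ,
      arcIntegral Q f (fun τ => p (t₀ + τ * (t₁ - t₀)))
        = ∫ τ in (0 : ℝ)..1, f (p (t₀ + τ * (t₁ - t₀)))
          * (((t₁ - t₀ : ℝ) : ℂ) * w (t₀ + τ * (t₁ - t₀))) := by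
  have hpc : ContinuousOn p J := fun t ht => (hd t ht).continuousAt.continuousWithinAt
  have hm := mapsTo_segment hJc h₀ h₁
  have hcd : ContDiffOn ℝ 1 p J := by
    rw [contDiffOn_one_iff_derivWithin hJ.uniqueDiffOn]
    refine ⟨fun t ht => (hd t ht).differentiableAt.differentiableWithinAt, ?_⟩
    have hc : ContinuousOn
        (fun t => ((p t).2 * w t, (derivative Q).eval (p t).1 / 2 * w t)) J := by
      refine (hpc.snd.mul hw).prodMk ((ContinuousOn.div_const ?_ _).mul hw)
      exact (derivative Q).continuous.comp_continuousOn hpc.fst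
    exact hc.congr fun t ht => (hd t ht).hasDerivWithinAt.derivWithin (hJ.uniqueDiffWithinAt ht)
  refine ⟨⟨hcd.comp (contDiff_const.add (contDiff_id.mul contDiff_const)).contDiffOn hm,
    fun τ hτ => hp _ (hm hτ)⟩, fun f => ?_⟩
  refine intervalIntegral.integral_congr fun τ hτ => ?_
  rw [Set.uIcc_of_le zero_le_one] at hτ
  have hin : HasDerivAt (fun τ : ℝ => t₀ + τ * (t₁ - t₀)) (t₁ - t₀) τ := by
    simpa using ((hasDerivAt_id τ).mul_const (t₁ - t₀)).const_add t₀
  have h := (hd _ (hm hτ)).scomp τ hin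
  have h' : derivWithin (fun τ => p (t₀ + τ * (t₁ - t₀))) (Set.Icc 0 1) τ = _ :=
    h.hasDerivWithinAt.derivWithin (uniqueDiffOn_Icc zero_lt_one τ hτ)
  simp only [h']
  rw [← formValue_of_speed hQ f (hp _ (hm hτ))]
  congr 1
  refine Prod.ext ?_ ?_
  · simp only [Prod.smul_mk, Complex.real_smul]
    ring
  · simp only [Prod.smul_mk, Complex.real_smul]
    ring
end JCG

end

theorem mainTheorem4 (n : ℕ) (ε : Fin n → ℝ) (hε : Function.Injective ε) (s : ℝ)
    (i : Fin (n + 1)) (J : Set ℝ) (hJ : IsOpen J) (hJc : J.OrdConnected)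
    (x : ℝ → JCG.Phase n) (hxs : ∀ t ∈ J, x t ∈ JCG.phaseSpace n s)
    (hx : JCG.IsHamiltonianTrajectory (JCG.hamiltonian ε i) x J)
    (Q : Polynomial ℂ) (hQ : ∃ t₀ ∈ J, JCG.spectralPoly ε (x t₀) = Q) (hsq : Squarefree Q)
    (p : Fin n → ℝ → ℂ × ℂ) (hpc : ∀ k, ContinuousOn (p k) J)
    (hpole : ∀ t ∈ J, ∀ k, JCG.IsPole ε (x t) (p k t))
    (hpinj : ∀ t ∈ J, Function.Injective fun k => p k t) :
    (∀ t ∈ J, JCG.spectralPoly ε (x t) = Q) ∧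
    ∃ σ : Module.Basis (Fin n) ℂ (JCG.holomorphicDifferentials n Q),
      (∀ j, ∀ q ∈ JCG.curve Q,
        (σ j : ℂ × ℂ → ℂ) q = ∏ l ∈ Finset.univ.erase j, (q.1 - (ε l : ℂ))) ∧
      (∀ t ∈ J, (∀ k, DifferentiableAt ℝ (p k) t) ∧
        ∀ j, ∑ k, JCG.formValue Q (σ j) (p k t) (deriv (p k) t)
          = if i = j.castSucc then Complex.I else 0) ∧
      ∀ η : Module.Basis (Fin n) ℂ (JCG.holomorphicDifferentials n Q),
        ∃ c : Fin n → ℂ,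
          (∀ m, c m = ∑ j, σ.repr (η m) j * (if i = j.castSucc then Complex.I else 0)) ∧
          (∀ t ∈ J, ∀ m, ∑ k, JCG.formValue Q (η m) (p k t) (deriv (p k) t) = c m) ∧
          ∀ (p₀ : Fin n → ℂ × ℂ) (t₀ t₁ : ℝ), t₀ ∈ J → t₁ ∈ J →
            ∀ u₀ u₁ : JCG.Jacobian Q (fun m => (η m : ℂ × ℂ → ℂ)),
              JCG.IsAbelImage Q (fun m => (η m : ℂ × ℂ → ℂ)) p₀ (fun k => p k t₀) u₀ →
              JCG.IsAbelImage Q (fun m => (η m : ℂ × ℂ → ℂ)) p₀ (fun k => p k t₁) u₁ →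
              u₁ = u₀ + QuotientAddGroup.mk (((t₁ - t₀ : ℝ) : ℂ) • c) := by
  open JCG in
  have hQt : ∀ t ∈ J, spectralPoly ε (x t) = Q := by
    obtain ⟨t₀, ht₀, rfl⟩ := hQ
    exact fun t ht => spectralPoly_const ε hε i hJ hJc hx ht ht₀
  have hdeg : Q.natDegree = 2 * n + 2 := by
    obtain ⟨t₀, ht₀, rfl⟩ := hQ
    exact natDegree_spectralPoly ε _
  have hcurve : ∀ t ∈ J, ∀ k, p k t ∈ curve Q := fun t ht k => hQt t ht ▸ (hpole t ht k).1
  -- the separated variables are determined by their `l` coordinates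
  have hinj : ∀ t ∈ J, Function.Injective fun k => (p k t).1 := by
    intro t ht k r hkr
    refine hpinj t ht (Prod.ext hkr ?_)
    simp only at hkr
    simp only [(hpole t ht k).numC_ne_zero_and.2.2, (hpole t ht r).numC_ne_zero_and.2.2, hkr]
  set w : Fin n → ℝ → ℂ := fun k t => separatedSpeed ε i (fun r => (p r t).1) k with hw
  have hd : ∀ k, ∀ t ∈ J, HasDerivAt (p k)
      ((p k t).2 * w k t, (derivative Q).eval (p k t).1 / 2 * w k t) t := by
    intro k t ht
    have h := hasDerivAt_separated hε hJ hx hpc hpole ht (hinj t ht) k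
    rwa [hQt t ht] at h
  have hform : ∀ t ∈ J, ∀ (f : ℂ × ℂ → ℂ) (k : Fin n),
      formValue Q f (p k t) (deriv (p k) t) = f (p k t) * w k t := by
    intro t ht f k
    rw [(hd k t ht).deriv, formValue_of_speed hsq f (hcurve t ht k)]
  obtain ⟨σ, hσ⟩ := exists_basis_holomorphicDifferentials hε hdeg hsq
  have hσsum : ∀ t ∈ J, ∀ j, ∑ k, (σ j : ℂ × ℂ → ℂ) (p k t) * w k t
      = if i = j.castSucc then Complex.I else 0 := by
    intro t ht j
    rw [← sum_eval_poleProdErase_mul_separatedSpeed hε i (hinj t ht) j]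
    refine Finset.sum_congr rfl fun k _ => ?_
    rw [hσ, polyDifferential_of_mem _ (hcurve t ht k)]
  refine ⟨hQt, σ, fun j q hq => ?_, fun t ht => ⟨fun k => (hd k t ht).differentiableAt,
    fun j => ?_⟩, fun η => ?_⟩
  · rw [hσ, polyDifferential_of_mem _ hq, poleProdErase, eval_prod]
    simp
  · simp only [hform t ht, hσsum t ht]
  set c : Fin n → ℂ := fun m => ∑ j, σ.repr (η m) j * (if i = j.castSucc then Complex.I else 0)
    with hc
  have hηsum : ∀ t ∈ J, ∀ m, ∑ k, (η m : ℂ × ℂ → ℂ) (p k t) * w k t = c m := by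
    intro t ht m
    have he : ∀ q, (η m : ℂ × ℂ → ℂ) q = ∑ j, σ.repr (η m) j * (σ j : ℂ × ℂ → ℂ) q := by
      intro q
      have h := congrArg (fun z : holomorphicDifferentials n Q => (z : ℂ × ℂ → ℂ) q)
        (σ.sum_repr (η m)).symm
      exact h.trans (by simp [-Module.Basis.sum_repr])
    simp only [hc, ← hσsum t ht, he, Finset.sum_mul, Finset.mul_sum]
    rw [Finset.sum_comm]
    exact Finset.sum_congr rfl fun j _ => Finset.sum_congr rfl fun k _ => by ring
  refine ⟨c, fun m => rfl, fun t ht m => ?_, fun p₀ t₀ t₁ ht₀ ht₁ u₀ u₁ hu₀ hu₁ => ?_⟩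
  · simp only [hform t ht, hηsum t ht]
  have hwc : ∀ k, ContinuousOn (w k) J := fun k =>
    continuousOn_separatedSpeed ε i (fun r => (hpc r).fst) hinj k
  have harc := fun k => isArc_and_arcIntegral_of_speed hsq hJ hJc (fun t ht => hcurve t ht k)
    (hwc k) (hd k) ht₀ ht₁
  have hpath : ∀ k, PathIntegral Q (fun m => (η m : ℂ × ℂ → ℂ)) (p k t₀) (p k t₁)
      (fun m => arcIntegral Q (η m) (fun τ => p k (t₀ + τ * (t₁ - t₀)))) := by
    intro k
    have h := PathIntegral.snoc (η := fun m => (η m : ℂ × ℂ → ℂ)) (p k t₀) 0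
      (fun τ => p k (t₀ + τ * (t₁ - t₀)))
      (by simpa using PathIntegral.nil (p k t₀) (hcurve t₀ ht₀ k)) (harc k).1
    simpa using h
  rw [hu₀.eq_add hu₁ hpath]
  congr 2
  funext m
  have hm := mapsTo_segment hJc ht₀ ht₁
  have hmc : ContinuousOn (fun τ : ℝ => t₀ + τ * (t₁ - t₀)) (Set.Icc 0 1) := by fun_prop
  simp only [Finset.sum_apply, (harc _).2, Pi.smul_apply, smul_eq_mul]
  rw [← intervalIntegral.integral_finsetSum]
  · have hconst : ∀ τ ∈ Set.uIcc (0 : ℝ) 1, ∑ k, (η m : ℂ × ℂ → ℂ) (p k (t₀ + τ * (t₁ - t₀)))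
        * (((t₁ - t₀ : ℝ) : ℂ) * w k (t₀ + τ * (t₁ - t₀))) = ((t₁ - t₀ : ℝ) : ℂ) * c m := by
      intro τ hτ
      rw [Set.uIcc_of_le zero_le_one] at hτ
      rw [← hηsum _ (hm hτ) m, Finset.mul_sum]
      exact Finset.sum_congr rfl fun k _ => by ring
    rw [intervalIntegral.integral_congr hconst]
    simp
  · intro k _
    refine ContinuousOn.intervalIntegrable ?_
    rw [Set.uIcc_of_le zero_le_one]
    have hη : HolomorphicOnCurve Q (η m) := (η m).2.2.1
    have h1 : ContinuousOn (fun t => (η m : ℂ × ℂ → ℂ) (p k t)) J :=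
      hη.continuousOn.comp (hpc k) fun t ht => hcurve t ht k
    exact (h1.comp hmc hm).mul (continuousOn_const.mul ((hwc k).comp hmc hm))
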